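/- Fix $R>0$. A packing (of the Euclidean plane $\mathbb E^2$ by disks of radius $R$) is a collection of closed disks of radius $R$ whose interiors are pairwise disjoint. Let $\mathcal P_R$ be the space of all such packings, with the topology of uniform convergence on compact subsets of $\mathbb E^2$: $P_k\to P$ if for every $\varepsilon>0$ and all large $k$, each disk of $P_k$ with center at distance at most $1/\varepsilon$ from the origin is within $\varepsilon$ of a disk of $P$, and vice versa. Let $\mathcal G$ be the group of orientation-preserving isometries of $\mathbb E^2$, acting naturally on $\mathcal P_R$, let $\nu$ be a Haar measure on $\mathcal G$, and for $p\in\mathbb E^2$ and $r>0$ put $\mathcal G(r,p)=\{g\in\mathcal G : d(g(p),p)<r\}$. For a $\mathcal G$-invariant Borel probability measure $\mu$ on $\mathcal P_R$ let $D(\mu)=\mu(\{P : \text{the origin lies in a disk of } P\})$. Such a $\mu$ is ergodic if it cannot be written as $a_1\mu_1+a_2\mu_2$ with $a_1,a_2>0$ and $\mu_1\neq\mu_2$ invariant probability measures. It is optimally dense if it is ergodic and $D(\mu)=\sup_{\mu'}D(\mu')$, the supremum being over all $\mathcal G$-invariant Borel probability measures $\mu'$ on $\mathcal P_R$. A packing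 $P$ is optimally dense if there is an optimally dense $\mu$ such that $P$ lies in the support of $\mu$ and $$\int_{\mathcal P_R} f\,d\mu=\lim_{r\to\infty}\frac1{\nu(\mathcal G(r,p))}\int_{\mathcal G(r,p)}f(g(P))\,d\nu(g)$$ for every $p\in\mathbb E^2$ and every continuous $f:\mathcal P_R\to\mathbb R$. Theorem 1. Up to rigid motion there is exactly one optimally dense packing of $\mathbb E^2$ by disks of radius $R$. More precisely, the set of optimally dense packings is exactly the $\mathcal G$-orbit of the hexagonal packing, the packing whose disk centers are the points of the triangular lattice generated by $(2R,0)$ and $(R,\sqrt3R)$. -/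

import Mathlib

/-!
The Euclidean plane is modelled by `ℂ`, whose distance is the Euclidean one.
-/

noncomputable section

/-- The connected group of rigid motions (orientation-preserving isometries) of the plane:
the pair `(u, w)` with `|u| = 1` stands for the motion `z ↦ u * z + w`. -/
@[ext]
structure RigidMotion where
  rot : Circle
  trans : ℂ

namespace RigidMotion

/-- Composition of motions. -/
instance : Mul RigidMotion := ⟨fun g h => ⟨g.rot * h.rot, (g.rot : ℂ) * h.trans + g.trans⟩⟩

instance : One RigidMotion := ⟨⟨1, 0⟩⟩

instance : Inv RigidMotion := ⟨fun g => ⟨g.rot⁻¹, -(((g.rot⁻¹ : Circle) : ℂ) * g.trans)⟩⟩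

theorem mul_rot (g h : RigidMotion) : (g * h).rot = g.rot * h.rot := rfl

theorem mul_trans (g h : RigidMotion) :
    (g * h).trans = (g.rot : ℂ) * h.trans + g.trans := rfl

theorem one_rot : (1 : RigidMotion).rot = 1 := rfl

theorem one_trans : (1 : RigidMotion).trans = 0 := rfl

theorem inv_rot (g : RigidMotion) : (g⁻¹).rot = g.rot⁻¹ := rfl

theorem inv_trans (g : RigidMotion) :
    (g⁻¹).trans = -(((g.rot⁻¹ : Circle) : ℂ) * g.trans) := rfl

instance : Group RigidMotion :=
  Group.ofLeftAxioms
    (fun a b c => by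
      ext
      · simp [mul_rot, mul_assoc]
      · simp only [mul_rot, mul_trans, Circle.coe_mul]; ring)
    (fun a => by
      ext
      · simp [mul_rot, one_rot]
      · simp [mul_trans, one_rot, one_trans])
    (fun a => by
      ext
      · simp [mul_rot, one_rot, inv_rot]
      · simp [mul_trans, one_trans, inv_rot, inv_trans])

/-- The action of rigid motions on the points of the plane. -/
instance : MulAction RigidMotion ℂ where
  smul g z := (g.rot : ℂ) * z + g.trans
  one_smul z := by
    change ((1 : Circle) : ℂ) * z + 0 = z
    simp
  mul_smul g h z := by
    change ((g.rot * h.rot : Circle) : ℂ) * z + ((g.rot : ℂ) * h.trans + g.trans)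
      = (g.rot : ℂ) * ((h.rot : ℂ) * z + h.trans) + g.trans
    simp only [Circle.coe_mul]; ring

theorem smul_def (g : RigidMotion) (z : ℂ) : g • z = (g.rot : ℂ) * z + g.trans := rfl

theorem dist_smul (g : RigidMotion) (x y : ℂ) : dist (g • x) (g • y) = dist x y := by
  rw [smul_def, smul_def, dist_add_right, dist_eq_norm, dist_eq_norm, ← mul_sub, norm_mul,
    Circle.norm_coe, one_mul]

def equivProd : RigidMotion ≃ Circle × ℂ where
  toFun g := (g.rot, g.trans)
  invFun p := ⟨p.1, p.2⟩
  left_inv _ := rfl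
  right_inv _ := rfl

/-- The usual topology of the group, that of `Circle × ℂ`. -/
instance : TopologicalSpace RigidMotion := TopologicalSpace.induced equivProd inferInstance

def homeoProd : RigidMotion ≃ₜ Circle × ℂ := equivProd.toHomeomorphOfIsInducing ⟨rfl⟩

theorem continuous_rot : Continuous RigidMotion.rot :=
  continuous_fst.comp homeoProd.continuous

theorem continuous_trans : Continuous RigidMotion.trans :=
  continuous_snd.comp homeoProd.continuous

instance : IsTopologicalGroup RigidMotion where
  continuous_mul := by
    refine homeoProd.comp_continuous_iff.1 ?_
    have h1 := continuous_rot
    have h2 := continuous_trans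
    change Continuous fun p : RigidMotion × RigidMotion =>
      (p.1.rot * p.2.rot, (p.1.rot : ℂ) * p.2.trans + p.1.trans)
    fun_prop
  continuous_inv := by
    refine homeoProd.comp_continuous_iff.1 ?_
    have h1 := continuous_rot
    have h2 := continuous_trans
    change Continuous fun g : RigidMotion =>
      (g.rot⁻¹, -(((g.rot⁻¹ : Circle) : ℂ) * g.trans))
    fun_prop

instance : LocallyCompactSpace RigidMotion :=
  homeoProd.isClosedEmbedding.locallyCompactSpace

instance : MeasurableSpace RigidMotion := borel RigidMotion

instance : BorelSpace RigidMotion := ⟨rfl⟩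

/-- The set of motions that move the point `p` by less than `r`. -/
def near (r : ℝ) (p : ℂ) : Set RigidMotion := {g | dist (g • p) p < r}

end RigidMotion

/-- A packing of the plane by closed disks of radius `R`, recorded by the set of the centres
of its disks: distinct disks have disjoint interiors. -/
@[ext]
structure DiskPacking (R : ℝ) where
  centers : Set ℂ
  disjoint_interiors :
    centers.Pairwise fun x y => Disjoint (Metric.ball x R) (Metric.ball y R)

namespace DiskPacking

variable {R : ℝ}

/-- The region covered by the disks of a packing. -/
def covered (P : DiskPacking R) : Set ℂ := ⋃ x ∈ P.centers, Metric.closedBall x R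

/-- Every disk of `P` centred in the closed disk of radius `1 / ε` about the origin is
`ε`-close to a disk of `Q`, and conversely. (The Hausdorff distance of two disks of radius `R`
is the distance of their centres.) -/
def Close (ε : ℝ) (P Q : DiskPacking R) : Prop :=
  (∀ x ∈ P.centers, ‖x‖ ≤ 1 / ε → ∃ y ∈ Q.centers, dist x y ≤ ε) ∧
    ∀ y ∈ Q.centers, ‖y‖ ≤ 1 / ε → ∃ x ∈ P.centers, dist x y ≤ ε

theorem Close.mono {δ ε : ℝ} (hδ : 0 < δ) (h : δ ≤ ε) {P Q : DiskPacking R}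
    (hc : Close δ P Q) : Close ε P Q := by
  have h1 : 1 / ε ≤ 1 / δ := one_div_le_one_div_of_le hδ h
  constructor
  · intro x hx hn
    obtain ⟨y, hy, hd⟩ := hc.1 x hx (hn.trans h1)
    exact ⟨y, hy, hd.trans h⟩
  · intro y hy hn
    obtain ⟨x, hx, hd⟩ := hc.2 y hy (hn.trans h1)
    exact ⟨x, hx, hd.trans h⟩

/-- The topology of uniform convergence on compact subsets of the plane. -/
instance : TopologicalSpace (DiskPacking R) where
  IsOpen U := ∀ P ∈ U, ∃ ε > 0, ∀ Q, Close ε P Q → Q ∈ U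
  isOpen_univ _ _ := ⟨1, one_pos, fun _ _ => trivial⟩
  isOpen_inter U V hU hV P hP := by
    obtain ⟨ε, hε, h⟩ := hU P hP.1
    obtain ⟨δ, hδ, h'⟩ := hV P hP.2
    have hm : 0 < min ε δ := lt_min hε hδ
    exact ⟨min ε δ, hm, fun Q hQ =>
      ⟨h Q (hQ.mono hm (min_le_left _ _)), h' Q (hQ.mono hm (min_le_right _ _))⟩⟩
  isOpen_sUnion S hS P hP := by
    obtain ⟨U, hU, hPU⟩ := hP
    obtain ⟨ε, hε, h⟩ := hS U hU P hPU
    exact ⟨ε, hε, fun Q hQ => ⟨U, hU, h Q hQ⟩⟩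

instance : MeasurableSpace (DiskPacking R) := borel (DiskPacking R)

instance : BorelSpace (DiskPacking R) := ⟨rfl⟩

/-- The natural action of rigid motions on packings: every disk is moved. -/
instance : MulAction RigidMotion (DiskPacking R) where
  smul g P :=
    { centers := (fun z => g • z) '' P.centers
      disjoint_interiors := by
        rintro _ ⟨x, hx, rfl⟩ _ ⟨y, hy, rfl⟩ hxy
        have hd : Disjoint (Metric.ball x R) (Metric.ball y R) := P.disjoint_interiors hx hy
          (fun h => hxy (by rw [h]))
        rw [Set.disjoint_left] at hd ⊢
        intro z h1 h2
        refine hd (a := g⁻¹ • z) ?_ ?_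
        · rw [Metric.mem_ball] at h1 ⊢
          rwa [← g.dist_smul, smul_inv_smul]
        · rw [Metric.mem_ball] at h2 ⊢
          rwa [← g.dist_smul, smul_inv_smul] }
  one_smul P := by
    apply DiskPacking.ext
    change (fun z => (1 : RigidMotion) • z) '' P.centers = P.centers
    simp
  mul_smul g h P := by
    apply DiskPacking.ext
    change (fun z => (g * h) • z) '' P.centers
      = (fun z => g • z) '' ((fun z => h • z) '' P.centers)
    simp [Set.image_image, mul_smul]

open MeasureTheory Filter Topology
open scoped ENNReal NNReal

/-- Borel probability measures on the space of packings, invariant under rigid motions. -/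
def IsInvariantProbability (μ : Measure (DiskPacking R)) : Prop :=
  IsProbabilityMeasure μ ∧ SMulInvariantMeasure RigidMotion (DiskPacking R) μ

/-- An invariant probability measure is ergodic if it is not a nontrivial average of two
different ones. -/
def IsErgodicProbability (μ : Measure (DiskPacking R)) : Prop :=
  IsInvariantProbability μ ∧
    ∀ (a₁ a₂ : ℝ≥0) (μ₁ μ₂ : Measure (DiskPacking R)), 0 < a₁ → 0 < a₂ →
      IsInvariantProbability μ₁ → IsInvariantProbability μ₂ →
      μ = a₁ • μ₁ + a₂ • μ₂ → μ₁ = μ₂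

/-- The density of a measure: the probability that the origin is in a disk. -/
def density (μ : Measure (DiskPacking R)) : ℝ≥0∞ :=
  μ {P | (0 : ℂ) ∈ P.covered}

/-- The optimal density for packing disks of radius `R`. -/
def optimalDensity (R : ℝ) : ℝ≥0∞ :=
  ⨆ (μ : Measure (DiskPacking R)) (_ : IsInvariantProbability μ), density μ

/-- Optimally dense measures. -/
def IsOptimallyDenseMeasure (μ : Measure (DiskPacking R)) : Prop :=
  IsErgodicProbability μ ∧ density μ = optimalDensity R

/-- `P` is generic for `μ`: it is in the support of `μ`, and the averages of continuous
functions over its orbit converge to their integrals. -/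
def IsGeneric (P : DiskPacking R) (μ : Measure (DiskPacking R)) : Prop :=
  P ∈ μ.support ∧
    ∀ (p : ℂ) (f : C(DiskPacking R, ℝ)),
      Tendsto (fun r : ℝ => ⨍ g in RigidMotion.near r p, f (g • P) ∂Measure.haar) atTop
        (𝓝 (∫ Q, f Q ∂μ))

/-- Optimally dense packings. -/
def IsOptimallyDense (P : DiskPacking R) : Prop :=
  ∃ μ : Measure (DiskPacking R), IsOptimallyDenseMeasure μ ∧ IsGeneric P μ

/-- The hexagonal packing: the centres form the triangular lattice of minimal distance `2 R`
that is generated by `2 R` and `2 R * exp (i π / 3)`. -/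
def hexagonal (R : ℝ) : DiskPacking R where
  centers := {z | ∃ a b : ℤ, z = 2 * R * (a + b * (1 / 2 + (√3 / 2 : ℝ) * Complex.I))}
  disjoint_interiors := by
    rintro _ ⟨a, b, rfl⟩ _ ⟨c, d, rfl⟩ hne
    apply Metric.ball_disjoint_ball
    rcases le_or_gt R 0 with hR | hR
    · exact le_trans (by linarith) dist_nonneg
    have hz : (1 : ℤ) ≤ (a - c) ^ 2 + (a - c) * (b - d) + (b - d) ^ 2 := by
      by_contra! hlt
      have h1 : 4 * ((a - c) ^ 2 + (a - c) * (b - d) + (b - d) ^ 2)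
          = (2 * (a - c) + (b - d)) ^ 2 + 3 * (b - d) ^ 2 := by ring
      have h2 : (b - d) ^ 2 = 0 := by
        nlinarith [sq_nonneg (2 * (a - c) + (b - d)), sq_nonneg (b - d)]
      have h3 : b - d = 0 := by simpa using h2
      rw [h3] at hlt
      have h4 : (a - c) ^ 2 = 0 := by nlinarith [sq_nonneg (a - c)]
      have h5 : a - c = 0 := by simpa using h4
      apply hne
      rw [show a = c by omega, show b = d by omega]
    have hr : (1 : ℝ) ≤ ((a : ℝ) - c) ^ 2 + (a - c) * (b - d) + (b - d) ^ 2 := by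
      exact_mod_cast hz
    have h3 : √3 ^ 2 = 3 := Real.sq_sqrt (by norm_num)
    rw [dist_eq_norm, Complex.norm_def]
    apply Real.le_sqrt_of_sq_le
    simp only [Complex.normSq_apply, Complex.sub_re, Complex.sub_im, Complex.mul_re,
      Complex.mul_im, Complex.add_re, Complex.add_im, Complex.ofReal_re, Complex.ofReal_im,
      Complex.intCast_re, Complex.intCast_im, Complex.I_re, Complex.I_im, Complex.re_ofNat,
      Complex.im_ofNat, Complex.one_re, Complex.one_im, Complex.div_ofNat_re,
      Complex.div_ofNat_im]
    have key := mul_le_mul_of_nonneg_left hr (by positivity : 0 ≤ 4 * R ^ 2)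
    ring_nf at key ⊢
    rw [h3]
    nlinarith [key]

end DiskPacking

end

open MeasureTheory Filter Topology
open scoped ENNReal NNReal Pointwise

namespace DiskPacking

variable {R : ℝ}

theorem smul_mem_smul_centers (g : RigidMotion) {P : DiskPacking R} {x : ℂ}
    (hx : x ∈ P.centers) : g • x ∈ (g • P).centers := ⟨x, hx, rfl⟩

theorem Close.refl {ε : ℝ} (hε : 0 < ε) (P : DiskPacking R) : Close ε P P :=
  ⟨fun x hx _ => ⟨x, hx, by simpa using hε.le⟩, fun x hx _ => ⟨x, hx, by simpa using hε.le⟩⟩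

theorem one_div_add_le {ε δ : ℝ} (hε : 0 < ε) (hδ : 0 < δ) (h1 : δ ≤ 1 / 2) (h2 : δ ≤ ε / 2) :
    1 / ε + δ ≤ 1 / δ := by
  have h3 : 2 / ε ≤ 1 / δ := by
    rw [div_le_div_iff₀ hε hδ]; linarith
  have h4 : 2 ≤ 1 / δ := by
    rw [le_div_iff₀ hδ]; linarith
  have h5 : 2 / ε = 2 * (1 / ε) := by ring
  linarith

theorem Close.trans {ε δ : ℝ} (hε : 0 < ε) (hδ : 0 < δ) (h1 : δ ≤ 1 / 2) (h2 : δ ≤ ε / 2)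
    {P Q S : DiskPacking R} (hPQ : Close δ P Q) (hQS : Close δ Q S) : Close ε P S := by
  have h3 := one_div_add_le hε hδ h1 h2
  constructor
  · intro x hx hn
    obtain ⟨y, hy, hd⟩ := hPQ.1 x hx (by linarith)
    have hy' : ‖y‖ ≤ ‖x‖ + dist x y := by
      rw [dist_eq_norm]; exact norm_le_norm_add_norm_sub x y
    obtain ⟨z, hz, hd'⟩ := hQS.1 y hy (by linarith)
    exact ⟨z, hz, (dist_triangle _ _ _).trans (by linarith)⟩
  · intro z hz hn
    obtain ⟨y, hy, hd⟩ := hQS.2 z hz (by linarith)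
    have hy' : ‖y‖ ≤ ‖z‖ + dist y z := by
      rw [dist_eq_norm]; exact norm_le_norm_add_norm_sub' y z
    obtain ⟨x, hx, hd'⟩ := hPQ.2 y hy (by linarith)
    exact ⟨x, hx, (dist_triangle _ y _).trans (by linarith)⟩

theorem mem_nhds_iff_close {P : DiskPacking R} {U : Set (DiskPacking R)} :
    U ∈ 𝓝 P ↔ ∃ ε > 0, ∀ Q, Close ε P Q → Q ∈ U := by
  constructor
  · intro h
    obtain ⟨V, hVU, hV, hPV⟩ := mem_nhds_iff.1 h
    obtain ⟨ε, hε, h⟩ := hV P hPV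
    exact ⟨ε, hε, fun Q hQ => hVU (h Q hQ)⟩
  · rintro ⟨ε, hε, h⟩
    refine mem_nhds_iff.2 ⟨{Q | ∃ δ > 0, ∀ S, Close δ Q S → S ∈ U}, ?_, ?_, ⟨ε, hε, h⟩⟩
    · rintro Q ⟨δ, hδ, hQ⟩
      exact hQ Q (Close.refl hδ Q)
    · rintro Q ⟨δ, hδ, hQ⟩
      have hm : 0 < min (1 / 2) (δ / 2) := lt_min (by norm_num) (by linarith)
      exact ⟨_, hm, fun S hS => ⟨_, hm, fun S' hS' =>
        hQ S' (hS.trans hδ hm (min_le_left _ _) (min_le_right _ _) hS')⟩⟩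

theorem eventually_dist_smul_le (g₀ : RigidMotion) {B δ : ℝ} (hδ : 0 < δ) :
    ∀ᶠ g in 𝓝 g₀, ∀ x : ℂ, ‖x‖ ≤ B → dist (g • x) (g₀ • x) ≤ δ := by
  have h1 : Tendsto (fun g : RigidMotion => ‖(g.rot : ℂ) - g₀.rot‖ * |B|
      + ‖g.trans - g₀.trans‖) (𝓝 g₀) (𝓝 0) := by
    have hr : Continuous fun g : RigidMotion => (g.rot : ℂ) := by
      have := RigidMotion.continuous_rot
      fun_prop
    have ht := RigidMotion.continuous_trans
    have hc : Continuous fun g : RigidMotion => ‖(g.rot : ℂ) - g₀.rot‖ * |B|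
      + ‖g.trans - g₀.trans‖ := by fun_prop
    simpa using hc.tendsto g₀
  filter_upwards [h1.eventually (gt_mem_nhds hδ)] with g hg x hx
  have h2 : g • x - g₀ • x = ((g.rot : ℂ) - g₀.rot) * x + (g.trans - g₀.trans) := by
    rw [RigidMotion.smul_def, RigidMotion.smul_def]; ring
  rw [dist_eq_norm, h2]
  refine (norm_add_le _ _).trans (le_trans ?_ hg.le)
  rw [norm_mul]
  gcongr
  exact hx.trans (le_abs_self B)

instance : ContinuousSMul RigidMotion (DiskPacking R) where
  continuous_smul := by
    rw [continuous_iff_continuousAt]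
    rintro ⟨g₀, P₀⟩ U hU
    obtain ⟨ε, hε, h⟩ := mem_nhds_iff_close.1 hU
    obtain ⟨δ, hδ, hδ1, hδε, hδB⟩ : ∃ δ > 0, δ ≤ 1 ∧ δ ≤ ε / 2 ∧
        δ ≤ 1 / (1 / ε + ‖g₀.trans‖ + 2) := by
      refine ⟨min 1 (min (ε / 2) (1 / (1 / ε + ‖g₀.trans‖ + 2))), ?_, ?_, ?_, ?_⟩
      · have : 0 < 1 / ε + ‖g₀.trans‖ + 2 := by positivity
        refine lt_min one_pos (lt_min (by linarith) (by positivity))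
      · exact min_le_left _ _
      · exact (min_le_right _ _).trans (min_le_left _ _)
      · exact (min_le_right _ _).trans (min_le_right _ _)
    have hB : 1 / ε + ‖g₀.trans‖ + 2 ≤ 1 / δ := by
      rw [le_div_iff₀ hδ]
      rwa [le_div_iff₀ (by positivity), mul_comm] at hδB
    have hP : {P | Close δ P₀ P} ∈ 𝓝 P₀ := mem_nhds_iff_close.2 ⟨δ, hδ, fun _ h => h⟩
    have hg := eventually_dist_smul_le g₀ (B := 1 / δ) hδ
    have hnorm : ∀ x : ℂ, ‖x‖ ≤ ‖g₀ • x‖ + ‖g₀.trans‖ := by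
      intro x
      have h1 : (g₀.rot : ℂ) * x = g₀ • x - g₀.trans := by
        rw [RigidMotion.smul_def]; ring
      calc ‖x‖ = ‖(g₀.rot : ℂ) * x‖ := by rw [norm_mul, Circle.norm_coe, one_mul]
        _ ≤ _ := by rw [h1]; exact norm_sub_le _ _
    have hg' : ∀ᶠ g in 𝓝 g₀, ‖g.trans‖ ≤ ‖g₀.trans‖ + 1 := by
      have : Tendsto (fun g : RigidMotion => ‖g.trans‖) (𝓝 g₀) (𝓝 ‖g₀.trans‖) :=
        (RigidMotion.continuous_trans.norm).tendsto g₀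
      exact (this.eventually (gt_mem_nhds (lt_add_one _))).mono fun _ h => h.le
    rw [nhds_prod_eq, mem_map]
    filter_upwards [prod_mem_prod (hg.and hg') hP]
    rintro ⟨g, P⟩ ⟨⟨hg1, hg2⟩, hc⟩
    refine h _ ⟨?_, ?_⟩
    · rintro _ ⟨x, hx, rfl⟩ hn
      have h1 := hnorm x
      obtain ⟨y, hy, hd⟩ := hc.1 x hx (by simp only at hn; linarith)
      refine ⟨g • y, smul_mem_smul_centers g hy, ?_⟩
      have h2 := hg1 x (by simp only at hn; linarith)
      calc dist (g₀ • x) (g • y) ≤ dist (g₀ • x) (g • x) + dist (g • x) (g • y) :=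
            dist_triangle _ _ _
        _ ≤ ε := by rw [RigidMotion.dist_smul, dist_comm]; linarith
    · rintro _ ⟨y, hy, rfl⟩ hn
      have h1 : ‖y‖ ≤ ‖g • y‖ + ‖g.trans‖ := by
        have h1 : (g.rot : ℂ) * y = g • y - g.trans := by
          rw [RigidMotion.smul_def]; ring
        calc ‖y‖ = ‖(g.rot : ℂ) * y‖ := by rw [norm_mul, Circle.norm_coe, one_mul]
          _ ≤ _ := by rw [h1]; exact norm_sub_le _ _
      simp only at hn
      obtain ⟨x, hx, hd⟩ := hc.2 y hy (by linarith)
      refine ⟨g₀ • x, smul_mem_smul_centers g₀ hx, ?_⟩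
      have h2 := hg1 y (by linarith)
      calc dist (g₀ • x) (g • y) ≤ dist (g₀ • x) (g₀ • y) + dist (g₀ • y) (g • y) :=
            dist_triangle _ _ _
        _ ≤ ε := by rw [RigidMotion.dist_smul, dist_comm (g₀ • y)]; linarith

theorem two_mul_le_dist (hR : 0 < R) (P : DiskPacking R) {x y : ℂ} (hx : x ∈ P.centers)
    (hy : y ∈ P.centers) (hxy : x ≠ y) : 2 * R ≤ dist x y := by
  have h := (disjoint_ball_ball_iff hR hR).1 (P.disjoint_interiors hx hy hxy)
  linarith

theorem finite_centers_inter_closedBall (hR : 0 < R) (P : DiskPacking R) (c : ℂ) (r : ℝ) :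
    (P.centers ∩ Metric.closedBall c r).Finite := by
  by_contra hinf
  have hS : (P.centers ∩ Metric.closedBall c r).Infinite := hinf
  obtain ⟨u, hu, hmem⟩ : ∃ u : ℕ → ℂ, Function.Injective u ∧
      ∀ n, u n ∈ P.centers ∩ Metric.closedBall c r :=
    ⟨fun n => hS.natEmbedding _ n, fun a b h => (hS.natEmbedding _).injective
      (Subtype.ext h), fun n => (hS.natEmbedding _ n).2⟩
  obtain ⟨a, -, φ, hφ, hlim⟩ := (isCompact_closedBall c r).tendsto_subseq fun n => (hmem n).2
  obtain ⟨N, hN⟩ := Metric.cauchySeq_iff.1 hlim.cauchySeq (2 * R) (by linarith)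
  have h1 := hN N le_rfl (N + 1) (Nat.le_succ N)
  have h2 := P.two_mul_le_dist hR (hmem (φ N)).1 (hmem (φ (N + 1))).1
    (fun h => by
      have h3 := hφ.injective (hu h)
      omega)
  exact absurd h1 (not_lt.2 h2)

theorem mem_covered {P : DiskPacking R} {z : ℂ} :
    z ∈ P.covered ↔ ∃ x ∈ P.centers, dist z x ≤ R := by
  simp [covered]

theorem isClosed_zero_mem_covered (hR : 0 < R) :
    IsClosed {P : DiskPacking R | (0 : ℂ) ∈ P.covered} := by
  refine ⟨isOpen_iff_mem_nhds.2 fun P hP => ?_⟩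
  have hP' : ∀ x ∈ P.centers, R < ‖x‖ := by
    intro x hx
    by_contra! h
    exact hP (mem_covered.2 ⟨x, hx, by simpa using h⟩)
  obtain ⟨δ, hδ, hδP⟩ : ∃ δ > 0, ∀ x ∈ P.centers, R + δ < ‖x‖ := by
    have hev : ∀ᶠ δ in 𝓝[>] (0 : ℝ), ∀ x ∈ P.centers ∩ Metric.closedBall 0 (R + 1),
        R + δ < ‖x‖ := by
      refine ((finite_centers_inter_closedBall hR P 0 (R + 1)).eventually_all).2 fun x hx => ?_
      have : Tendsto (fun δ : ℝ => R + δ) (𝓝[>] 0) (𝓝 R) := by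
        have : Continuous fun δ : ℝ => R + δ := by fun_prop
        simpa using (this.tendsto 0).mono_left nhdsWithin_le_nhds
      exact this.eventually (gt_mem_nhds (hP' x hx.1))
    have h1 : ∀ᶠ δ in 𝓝[>] (0 : ℝ), δ < 1 :=
      nhdsWithin_le_nhds (gt_mem_nhds one_pos)
    obtain ⟨δ, ⟨h2, h3⟩, h4⟩ := ((hev.and h1).and self_mem_nhdsWithin).exists
    refine ⟨δ, h4, fun x hx => ?_⟩
    by_cases hx1 : ‖x‖ ≤ R + 1
    · exact h2 x ⟨hx, by simpa using hx1⟩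
    · push Not at hx1; linarith
  have hm : 0 < min (δ / 2) (1 / (R + 1)) := lt_min (by linarith) (by positivity)
  refine mem_nhds_iff_close.2 ⟨min (δ / 2) (1 / (R + 1)), hm, fun Q hQ h0 => ?_⟩
  obtain ⟨y, hy, hyR⟩ := mem_covered.1 h0
  rw [dist_zero_left] at hyR
  have h1 : R + 1 ≤ 1 / min (δ / 2) (1 / (R + 1)) := by
    rw [le_div_iff₀ hm]
    calc (R + 1) * min (δ / 2) (1 / (R + 1)) ≤ (R + 1) * (1 / (R + 1)) := by
          gcongr; exact min_le_right _ _
      _ = 1 := by field_simp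
  obtain ⟨x, hx, hd⟩ := hQ.2 y hy (by linarith)
  have h2 := hδP x hx
  have h3 : ‖x‖ ≤ ‖y‖ + dist x y := by
    rw [dist_eq_norm]; exact norm_le_norm_add_norm_sub' x y
  have h4 := min_le_left (δ / 2) (1 / (R + 1))
  linarith

end DiskPacking

/-- The circumradius of the equilateral triangle of side `2 R`. -/
noncomputable def circumradius (R : ℝ) : ℝ := 2 * R / √3

/-- Half the angle under which the chord common to two circles of radius `circumradius R` with
centres at distance `d` is seen from either centre. -/
noncomputable def lensAngle (R d : ℝ) : ℝ := Real.arccos (d / (2 * circumradius R))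

/-- The area of the intersection of two disks of radius `circumradius R` with centres at
distance `d`. -/
noncomputable def lensArea (R d : ℝ) : ℝ :=
  2 * circumradius R ^ 2 *
    (lensAngle R d - Real.sin (lensAngle R d) * Real.cos (lensAngle R d))

/-- The total area of the six lenses at a centre of the hexagonal packing. -/
noncomputable def fullLensArea (R : ℝ) : ℝ := (2 * Real.pi - 3 * √3) * circumradius R ^ 2

theorem circumradius_pos {R : ℝ} (hR : 0 < R) : 0 < circumradius R := by
  unfold circumradius; positivity

theorem circumradius_sq (R : ℝ) : circumradius R ^ 2 = 4 * R ^ 2 / 3 := by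
  rw [circumradius, div_pow, Real.sq_sqrt (by norm_num)]; ring

theorem lensAngle_nonneg (R d : ℝ) : 0 ≤ lensAngle R d := Real.arccos_nonneg _

theorem continuous_lensArea (R : ℝ) : Continuous (lensArea R) := by
  unfold lensArea lensAngle
  have := Real.continuous_arccos
  fun_prop

theorem lensAngle_two_mul {R : ℝ} (hR : 0 < R) : lensAngle R (2 * R) = Real.pi / 6 := by
  have h : 2 * R / (2 * circumradius R) = Real.cos (Real.pi / 6) := by
    rw [Real.cos_pi_div_six, circumradius]
    field_simp
  rw [lensAngle, h, Real.arccos_cos (by positivity) (by linarith [Real.pi_pos])]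

theorem lensAngle_le {R d : ℝ} (hR : 0 < R) (hd : 2 * R ≤ d) : lensAngle R d ≤ Real.pi / 6 := by
  rw [← lensAngle_two_mul hR]
  have := circumradius_pos hR
  exact Real.antitone_arccos (by gcongr)

theorem lensAngle_lt {R d : ℝ} (hR : 0 < R) (hd : 2 * R < d) : lensAngle R d < Real.pi / 6 := by
  rcases le_or_gt 1 (d / (2 * circumradius R)) with h | h
  · rw [lensAngle, Real.arccos_of_one_le h]; positivity
  · rw [← lensAngle_two_mul hR]
    have := circumradius_pos hR
    refine Real.strictAntiOn_arccos ⟨?_, ?_⟩ ⟨?_, h.le⟩ (by gcongr)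
    · exact le_trans (by norm_num) (show 0 ≤ 2 * R / (2 * circumradius R) by positivity)
    · exact le_trans (by gcongr) h.le
    · exact le_trans (by norm_num)
        (show 0 ≤ d / (2 * circumradius R) from div_nonneg (by linarith) (by positivity))

theorem lensAngle_pos_iff {R d : ℝ} (hR : 0 < R) :
    0 < lensAngle R d ↔ d < 2 * circumradius R := by
  have := circumradius_pos hR
  rw [lensAngle, Real.arccos_pos, div_lt_one (by positivity)]

theorem cos_lensAngle {R d : ℝ} (hR : 0 < R) (hd : 0 ≤ d) (h : d ≤ 2 * circumradius R) :
    Real.cos (lensAngle R d) = d / (2 * circumradius R) := by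
  have := circumradius_pos hR
  rw [lensAngle, Real.cos_arccos]
  · exact le_trans (by norm_num) (show 0 ≤ d / (2 * circumradius R) by positivity)
  · rwa [div_le_one (by positivity)]

theorem lensArea_eq (R d : ℝ) :
    lensArea R d = circumradius R ^ 2 * (2 * lensAngle R d - Real.sin (2 * lensAngle R d)) := by
  rw [lensArea, Real.sin_two_mul]; ring

theorem mul_le_sin_of_le_pi_div_three {b : ℝ} (h0 : 0 ≤ b) (h1 : b ≤ Real.pi / 3) :
    b * (3 * √3 / (2 * Real.pi)) ≤ Real.sin b := by
  have hpi := Real.pi_pos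
  have hc := strictConcaveOn_sin_Icc.concaveOn.2 (Set.mem_Icc.2 ⟨le_rfl, hpi.le⟩)
    (Set.mem_Icc.2 ⟨by positivity, by linarith⟩ : Real.pi / 3 ∈ Set.Icc 0 Real.pi)
    (show 0 ≤ 1 - b / (Real.pi / 3) by
      rw [sub_nonneg, div_le_one (by positivity)]; exact h1)
    (show 0 ≤ b / (Real.pi / 3) by positivity) (by ring)
  simp only [smul_eq_mul, Real.sin_zero, mul_zero, zero_add, Real.sin_pi_div_three] at hc
  rw [div_mul_cancel₀ _ (by positivity)] at hc
  refine le_trans (le_of_eq ?_) hc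
  field_simp

theorem mul_lt_sin_of_lt_pi_div_three {b : ℝ} (h0 : 0 < b) (h1 : b < Real.pi / 3) :
    b * (3 * √3 / (2 * Real.pi)) < Real.sin b := by
  have hpi := Real.pi_pos
  have hc := strictConcaveOn_sin_Icc.2 (Set.mem_Icc.2 ⟨le_rfl, hpi.le⟩)
    (Set.mem_Icc.2 ⟨by positivity, by linarith⟩ : Real.pi / 3 ∈ Set.Icc 0 Real.pi)
    (by positivity) (show 0 < 1 - b / (Real.pi / 3) by
      rw [sub_pos, div_lt_one (by positivity)]; exact h1)
    (show 0 < b / (Real.pi / 3) by positivity) (by ring)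
  simp only [smul_eq_mul, Real.sin_zero, mul_zero, zero_add, Real.sin_pi_div_three] at hc
  rw [div_mul_cancel₀ _ (by positivity)] at hc
  refine lt_of_le_of_lt (le_of_eq ?_) hc
  field_simp

theorem fullLensArea_div_pi (R : ℝ) : fullLensArea R / Real.pi
    = 2 * circumradius R ^ 2 * (1 - 3 * √3 / (2 * Real.pi)) := by
  have := Real.pi_pos
  rw [fullLensArea]; field_simp

theorem lensArea_le {R d : ℝ} (hR : 0 < R) (hd : 2 * R ≤ d) :
    lensArea R d ≤ fullLensArea R / Real.pi * lensAngle R d := by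
  have h := mul_le_sin_of_le_pi_div_three (b := 2 * lensAngle R d)
    (by linarith [lensAngle_nonneg R d]) (by linarith [lensAngle_le hR hd])
  rw [lensArea_eq, fullLensArea_div_pi]
  nlinarith [sq_nonneg (circumradius R)]

theorem lensArea_lt {R d : ℝ} (hR : 0 < R) (hd : 2 * R < d) (hd' : d < 2 * circumradius R) :
    lensArea R d < fullLensArea R / Real.pi * lensAngle R d := by
  have h := mul_lt_sin_of_lt_pi_div_three (b := 2 * lensAngle R d)
    (by linarith [(lensAngle_pos_iff hR).2 hd']) (by linarith [lensAngle_lt hR hd])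
  rw [lensArea_eq, fullLensArea_div_pi]
  have := pow_pos (circumradius_pos hR) 2
  nlinarith

theorem fullLensArea_pos {R : ℝ} (hR : 0 < R) : 0 < fullLensArea R := by
  have h3 : √3 < 2 := by
    rw [Real.sqrt_lt' (by norm_num)]; norm_num
  have := Real.pi_gt_three
  have := circumradius_pos hR
  unfold fullLensArea
  have : 0 < 2 * Real.pi - 3 * √3 := by linarith
  positivity

theorem lensArea_nonneg (R d : ℝ) : 0 ≤ lensArea R d := by
  rw [lensArea_eq]
  have := Real.sin_le (x := 2 * lensAngle R d) (by linarith [lensAngle_nonneg R d])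
  have := sq_nonneg (circumradius R)
  apply mul_nonneg <;> linarith

theorem pi_mul_circumradius_sq_sub (R : ℝ) :
    Real.pi * circumradius R ^ 2 - fullLensArea R / 2 = 2 * √3 * R ^ 2 := by
  rw [fullLensArea, circumradius_sq]; ring

theorem integral_two_mul_sqrt_sub_sq {ρ a : ℝ} (hρ : 0 < ρ) (h0 : 0 ≤ a) (h1 : a ≤ Real.pi) :
    ∫ t in (ρ * Real.cos a)..ρ, 2 * √(ρ ^ 2 - t ^ 2)
      = ρ ^ 2 * (a - Real.sin a * Real.cos a) := by
  have h := intervalIntegral.integral_comp_mul_deriv (a := a) (b := 0)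
    (f := fun φ => ρ * Real.cos φ) (f' := fun φ => ρ * -Real.sin φ)
    (g := fun t => 2 * √(ρ ^ 2 - t ^ 2))
    (fun x _ => (Real.hasDerivAt_cos x).const_mul ρ) (by fun_prop) (by fun_prop)
  simp only [Real.cos_zero, mul_one] at h
  rw [← h]
  have h2 : ∫ φ in a..0, ((fun t => 2 * √(ρ ^ 2 - t ^ 2)) ∘ fun φ => ρ * Real.cos φ) φ
      * (ρ * -Real.sin φ) = ∫ φ in a..0, (-2 * ρ ^ 2) * Real.sin φ ^ 2 := by
    refine intervalIntegral.integral_congr fun φ hφ => ?_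
    rw [Set.uIcc_of_ge h0] at hφ
    have hs : 0 ≤ Real.sin φ := Real.sin_nonneg_of_nonneg_of_le_pi hφ.1 (hφ.2.trans h1)
    have h3 : ρ ^ 2 - (ρ * Real.cos φ) ^ 2 = (ρ * Real.sin φ) ^ 2 := by
      have := Real.sin_sq_add_cos_sq φ
      linear_combination (-ρ ^ 2) * this
    simp only [Function.comp_apply]
    rw [h3, Real.sqrt_sq (by positivity)]
    ring
  rw [h2, intervalIntegral.integral_const_mul, integral_sin_sq]
  simp
  ring

theorem volume_cap {ρ a : ℝ} (hρ : 0 < ρ) (h0 : 0 ≤ a) (h1 : a ≤ Real.pi / 2) :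
    volume {z : ℂ | ρ * Real.cos a ≤ z.re ∧ ‖z‖ < ρ}
      = ENNReal.ofReal (ρ ^ 2 * (a - Real.sin a * Real.cos a)) := by
  have hc : 0 ≤ Real.cos a := Real.cos_nonneg_of_neg_pi_div_two_le_of_le (by linarith) h1
  have hle : ρ * Real.cos a ≤ ρ := by
    nlinarith [Real.cos_le_one a]
  have hset : {z : ℂ | ρ * Real.cos a ≤ z.re ∧ ‖z‖ < ρ} = Complex.measurableEquivRealProd ⁻¹'
      regionBetween (fun t => -√(ρ ^ 2 - t ^ 2)) (fun t => √(ρ ^ 2 - t ^ 2))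
        (Set.Ico (ρ * Real.cos a) ρ) := by
    ext z
    simp only [Set.mem_ofPred_eq, Set.mem_preimage, regionBetween,
      Complex.measurableEquivRealProd_apply, Set.mem_Ico, Set.mem_Ioo, ← abs_lt]
    have h2 : ‖z‖ < ρ ↔ z.re ^ 2 + z.im ^ 2 < ρ ^ 2 := by
      rw [← sq_lt_sq₀ (norm_nonneg z) hρ.le, Complex.sq_norm, Complex.normSq_apply]
      ring_nf
    have h3 : |z.im| < √(ρ ^ 2 - z.re ^ 2) ↔ z.re ^ 2 + z.im ^ 2 < ρ ^ 2 := by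
      rw [Real.lt_sqrt (abs_nonneg _), sq_abs]
      constructor <;> intro h <;> linarith
    rw [h2, h3]
    constructor
    · rintro ⟨h4, h5⟩
      have : z.re < ρ := by nlinarith [mul_nonneg hρ.le hc, sq_nonneg z.im]
      exact ⟨⟨h4, this⟩, h5⟩
    · rintro ⟨⟨h4, -⟩, h5⟩
      exact ⟨h4, h5⟩
  have hint : ∀ s : ℝ → ℝ, Continuous s → IntegrableOn s (Set.Ico (ρ * Real.cos a) ρ) :=
    fun s hs => hs.integrableOn_Icc.mono_set Set.Ico_subset_Icc_self
  have hm : MeasurableSet (regionBetween (fun t => -√(ρ ^ 2 - t ^ 2)) (fun t => √(ρ ^ 2 - t ^ 2))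
        (Set.Ico (ρ * Real.cos a) ρ)) :=
    measurableSet_regionBetween (by fun_prop) (by fun_prop) measurableSet_Ico
  rw [hset, Complex.volume_preserving_equiv_real_prod.measure_preimage hm.nullMeasurableSet,
    Measure.volume_eq_prod,
    volume_regionBetween_eq_integral (hint _ (by fun_prop)) (hint _ (by fun_prop))
      measurableSet_Ico (fun t _ => by linarith [Real.sqrt_nonneg (ρ ^ 2 - t ^ 2)]),
    integral_Ico_eq_integral_Ioc, ← intervalIntegral.integral_of_le hle,
    ← integral_two_mul_sqrt_sub_sq hρ h0 (by linarith [Real.pi_pos])]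
  congr 1
  refine intervalIntegral.integral_congr fun t _ => ?_
  simp only [Pi.sub_apply]
  ring

theorem volume_cap_toward {ρ a : ℝ} (hρ : 0 < ρ) (h0 : 0 ≤ a) (h1 : a ≤ Real.pi / 2) (x : ℂ)
    (u : Circle) :
    volume {w : ℂ | ρ * Real.cos a ≤ ((u⁻¹ : Circle) * (w - x)).re ∧ ‖w - x‖ < ρ}
      = ENNReal.ofReal (ρ ^ 2 * (a - Real.sin a * Real.cos a)) := by
  rw [← volume_cap hρ h0 h1]
  have hp : MeasurePreserving (fun w : ℂ => rotation u⁻¹ (w - x)) volume volume :=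
    (rotation u⁻¹).measurePreserving.comp (measurePreserving_sub_right volume x)
  have hm : MeasurableSet {z : ℂ | ρ * Real.cos a ≤ z.re ∧ ‖z‖ < ρ} :=
    (measurableSet_le measurable_const Complex.measurable_re).inter
      (measurableSet_lt measurable_norm measurable_const)
  rw [← hp.measure_preimage hm.nullMeasurableSet]
  congr 1
  ext w
  change _ ↔ ρ * Real.cos a ≤ (rotation u⁻¹ (w - x)).re ∧ ‖rotation u⁻¹ (w - x)‖ < ρ
  rw [LinearIsometryEquiv.norm_map, rotation_apply]
  rfl

theorem exists_circle_mul (z : ℂ) : ∃ u : Circle, z = ‖z‖ * u :=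
  ⟨Circle.exp z.arg, by rw [Circle.coe_exp, Complex.norm_mul_exp_arg_mul_I]⟩

theorem half_le_re_of_norm_le {x y w : ℂ} {d : ℝ} (hd : 0 < d) {u : Circle}
    (hu : y - x = d * u) (h : ‖w - y‖ ≤ ‖w - x‖) :
    d / 2 ≤ ((u⁻¹ : Circle) * (w - x)).re := by
  set q : ℂ := (u⁻¹ : Circle) * (w - x) with hq
  have h1 : w - x = u * q := by
    rw [hq, ← mul_assoc, ← Circle.coe_mul, mul_inv_cancel, Circle.coe_one, one_mul]
  have h2 : w - y = u * (q - d) := by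
    linear_combination h1 - hu
  rw [h1, h2, norm_mul, norm_mul, Circle.norm_coe, one_mul, one_mul,
    ← sq_le_sq₀ (norm_nonneg _) (norm_nonneg _), Complex.sq_norm, Complex.sq_norm,
    Complex.normSq_apply, Complex.normSq_apply] at h
  simp only [Complex.sub_re, Complex.ofReal_re, Complex.sub_im, Complex.ofReal_im] at h
  nlinarith

theorem volume_ball_inter_ball_le {R : ℝ} (hR : 0 < R) {x y : ℂ} (hxy : x ≠ y) :
    volume (Metric.ball x (circumradius R) ∩ Metric.ball y (circumradius R))
      ≤ ENNReal.ofReal (lensArea R (dist x y)) := by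
  have hρ := circumradius_pos hR
  set ρ := circumradius R with hρdef
  rcases le_or_gt (2 * ρ) (dist x y) with h | h
  · have : Metric.ball x ρ ∩ Metric.ball y ρ = ∅ :=
      (Metric.ball_disjoint_ball (by linarith)).inter_eq
    rw [this]; simp
  set d := dist x y with hd
  have hd0 : 0 < d := dist_pos.2 hxy
  have hcos : ρ * Real.cos (lensAngle R d) = d / 2 := by
    rw [cos_lensAngle hR hd0.le h.le, ← hρdef]; field_simp
  have ha1 : lensAngle R d ≤ Real.pi / 2 := by
    rw [lensAngle, Real.arccos_le_pi_div_two]; positivity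
  have hn : ‖y - x‖ = d := by rw [hd, dist_comm, dist_eq_norm]
  obtain ⟨u, hu⟩ := exists_circle_mul (y - x)
  obtain ⟨v, hv⟩ := exists_circle_mul (x - y)
  rw [hn] at hu
  rw [← norm_neg, neg_sub, hn] at hv
  have hsub : Metric.ball x ρ ∩ Metric.ball y ρ ⊆
      {w : ℂ | ρ * Real.cos (lensAngle R d) ≤ ((u⁻¹ : Circle) * (w - x)).re ∧ ‖w - x‖ < ρ} ∪
      {w : ℂ | ρ * Real.cos (lensAngle R d) ≤ ((v⁻¹ : Circle) * (w - y)).re ∧ ‖w - y‖ < ρ} := by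
    rintro w ⟨h1, h2⟩
    rw [mem_ball_iff_norm] at h1 h2
    rw [hcos]
    rcases le_total ‖w - y‖ ‖w - x‖ with h3 | h3
    · exact Or.inl ⟨half_le_re_of_norm_le hd0 hu h3, h1⟩
    · exact Or.inr ⟨half_le_re_of_norm_le hd0 hv h3, h2⟩
  refine (measure_mono hsub).trans ((measure_union_le _ _).trans ?_)
  have h4 : 0 ≤ ρ ^ 2 * (lensAngle R d - Real.sin (lensAngle R d) * Real.cos (lensAngle R d)) := by
    have := lensArea_nonneg R d
    rw [lensArea, ← hρdef] at this
    linarith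
  rw [volume_cap_toward hρ (lensAngle_nonneg R d) ha1, volume_cap_toward hρ (lensAngle_nonneg R d)
    ha1, ← ENNReal.ofReal_add h4 h4, lensArea, ← hρdef]
  exact ENNReal.ofReal_le_ofReal (by linarith)

theorem not_three_near {R : ℝ} (hR : 0 < R) {x y y' z : ℂ} (hx : dist z x ≤ circumradius R)
    (hy : dist z y < circumradius R) (hy' : dist z y' < circumradius R)
    (hxy : 2 * R ≤ dist x y) (hxy' : 2 * R ≤ dist x y') (hyy' : 2 * R ≤ dist y y') : False := by
  have hρ := circumradius_sq R
  have hρ0 := circumradius_pos hR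
  have sq : ∀ a b : ℂ, dist a b ^ 2 = (a.re - b.re) ^ 2 + (a.im - b.im) ^ 2 := by
    intro a b
    rw [dist_eq_norm, Complex.sq_norm, Complex.normSq_apply, Complex.sub_re, Complex.sub_im]
    ring
  have h1 : dist z x ^ 2 ≤ circumradius R ^ 2 := by gcongr
  have h2 : dist z y ^ 2 < circumradius R ^ 2 := by gcongr
  have h3 : dist z y' ^ 2 < circumradius R ^ 2 := by gcongr
  have h4 : (2 * R) ^ 2 ≤ dist x y ^ 2 := by gcongr
  have h5 : (2 * R) ^ 2 ≤ dist x y' ^ 2 := by gcongr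
  have h6 : (2 * R) ^ 2 ≤ dist y y' ^ 2 := by gcongr
  rw [sq, hρ] at h1 h2 h3
  rw [sq] at h4 h5 h6
  nlinarith [sq_nonneg (3 * z.re - x.re - y.re - y'.re), sq_nonneg (3 * z.im - x.im - y.im - y'.im)]

theorem dist_lt_of_mem_arc {R : ℝ} (hR : 0 < R) {x y : ℂ} {s : ℝ} (hxy : x ≠ y)
    (h : (s : AddCircle (2 * Real.pi)) ∈
      Metric.ball ((y - x).arg : AddCircle (2 * Real.pi)) (lensAngle R (dist x y))) :
    dist (x + circumradius R * Complex.exp (s * Complex.I)) y < circumradius R := by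
  have hρ := circumradius_pos hR
  set ρ := circumradius R with hρdef
  set d := dist x y with hd
  have hd0 : 0 < d := dist_pos.2 hxy
  have hpos : 0 < lensAngle R d := Metric.pos_of_mem_ball h
  have hdlt : d < 2 * ρ := (lensAngle_pos_iff hR).1 hpos
  rw [mem_ball_iff_norm, ← AddCircle.coe_sub, AddCircle.norm_eq] at h
  set k := round ((2 * Real.pi)⁻¹ * (s - (y - x).arg))
  have hcos : Real.cos (lensAngle R d) < Real.cos (s - (y - x).arg) := by
    rw [← Real.cos_sub_int_mul_two_pi (s - (y - x).arg) k, ← Real.cos_abs (_ - _ * _)]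
    exact Real.cos_lt_cos_of_nonneg_of_le_pi (abs_nonneg _) (Real.arccos_le_pi _) h
  rw [cos_lensAngle hR dist_nonneg hdlt.le, ← hρdef, div_lt_iff₀ (by positivity)] at hcos
  have hn : ‖y - x‖ = d := by rw [hd, dist_comm, dist_eq_norm]
  have hre : (y - x).re = d * Real.cos (y - x).arg := by
    rw [← hn, Complex.norm_mul_cos_arg]
  have him : (y - x).im = d * Real.sin (y - x).arg := by
    rw [← hn, Complex.norm_mul_sin_arg]
  rw [dist_eq_norm, ← sq_lt_sq₀ (norm_nonneg _) hρ.le, Complex.sq_norm, Complex.normSq_apply]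
  have h1 : (x + ρ * Complex.exp (s * Complex.I) - y).re
      = ρ * Real.cos s - d * Real.cos (y - x).arg := by
    rw [← hre]
    simp [Complex.exp_ofReal_mul_I_re]
    ring
  have h2 : (x + ρ * Complex.exp (s * Complex.I) - y).im
      = ρ * Real.sin s - d * Real.sin (y - x).arg := by
    rw [← him]
    simp [Complex.exp_ofReal_mul_I_im]
    ring
  rw [h1, h2]
  rw [Real.cos_sub] at hcos
  have e1 := Real.sin_sq_add_cos_sq s
  have e2 := Real.sin_sq_add_cos_sq (y - x).arg
  have h3 := mul_lt_mul_of_pos_left hcos hd0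
  have e3 : (ρ * Real.cos s - d * Real.cos (y - x).arg)
    * (ρ * Real.cos s - d * Real.cos (y - x).arg)
    + (ρ * Real.sin s - d * Real.sin (y - x).arg) * (ρ * Real.sin s - d * Real.sin (y - x).arg)
    = ρ ^ 2 + d ^ 2 - 2 * ρ * d * (Real.cos s * Real.cos (y - x).arg
      + Real.sin s * Real.sin (y - x).arg) := by
    linear_combination ρ ^ 2 * e1 + d ^ 2 * e2
  rw [e3]
  nlinarith

theorem sum_lensAngle_le_pi {R : ℝ} (hR : 0 < R) (x : ℂ) (S : Finset ℂ)
    (hx : ∀ y ∈ S, 2 * R ≤ dist x y)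
    (hS : (S : Set ℂ).Pairwise fun y y' => 2 * R ≤ dist y y') :
    ∑ y ∈ S, lensAngle R (dist x y) ≤ Real.pi := by
  have : Fact (0 < 2 * Real.pi) := ⟨by positivity⟩
  have hdisj : (S : Set ℂ).PairwiseDisjoint fun y =>
      Metric.ball ((y - x).arg : AddCircle (2 * Real.pi)) (lensAngle R (dist x y)) := by
    intro y hy y' hy' hne
    rw [Function.onFun, Set.disjoint_left]
    intro t ht ht'
    induction t using QuotientAddGroup.induction_on with
    | H s =>
      have hne' : ∀ y ∈ S, x ≠ y := fun y hy h => by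
        have := hx y hy
        rw [h, dist_self] at this
        linarith
      refine not_three_near hR (z := x + circumradius R * Complex.exp (s * Complex.I)) ?_
        (dist_lt_of_mem_arc hR (hne' y hy) ht) (dist_lt_of_mem_arc hR (hne' y' hy') ht')
        (hx y hy) (hx y' hy')
        (hS hy hy' hne)
      rw [dist_self_add_left, norm_mul, Complex.norm_exp_ofReal_mul_I, mul_one, Complex.norm_real,
        Real.norm_of_nonneg (circumradius_pos hR).le]
  have hvol : ∀ y ∈ S, volume (Metric.ball ((y - x).arg : AddCircle (2 * Real.pi))
      (lensAngle R (dist x y))) = ENNReal.ofReal (2 * lensAngle R (dist x y)) := by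
    intro y hy
    rw [← measure_congr AddCircle.closedBall_ae_eq_ball, AddCircle.volume_closedBall,
      min_eq_right]
    linarith [lensAngle_le hR (hx y hy), Real.pi_pos]
  have h := measure_mono (μ := (volume : Measure (AddCircle (2 * Real.pi))))
    (Set.subset_univ (⋃ y ∈ S, Metric.ball ((y - x).arg : AddCircle (2 * Real.pi))
      (lensAngle R (dist x y))))
  rw [measure_biUnion_finset hdisj fun _ _ => measurableSet_ball, Finset.sum_congr rfl hvol,
    AddCircle.measure_univ, ← ENNReal.ofReal_sum_of_nonneg
      (fun y _ => by linarith [lensAngle_nonneg R (dist x y)]),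
    ENNReal.ofReal_le_ofReal_iff (by positivity), ← Finset.mul_sum] at h
  linarith

theorem sum_lensArea_le {R : ℝ} (hR : 0 < R) (x : ℂ) (S : Finset ℂ)
    (hx : ∀ y ∈ S, 2 * R ≤ dist x y)
    (hS : (S : Set ℂ).Pairwise fun y y' => 2 * R ≤ dist y y') :
    ∑ y ∈ S, lensArea R (dist x y) ≤ fullLensArea R := by
  have hpi := Real.pi_pos
  have hM := fullLensArea_pos hR
  calc ∑ y ∈ S, lensArea R (dist x y)
      ≤ ∑ y ∈ S, fullLensArea R / Real.pi * lensAngle R (dist x y) :=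
        Finset.sum_le_sum fun y hy => lensArea_le hR (hx y hy)
    _ = fullLensArea R / Real.pi * ∑ y ∈ S, lensAngle R (dist x y) := by rw [Finset.mul_sum]
    _ ≤ fullLensArea R / Real.pi * Real.pi := by
        gcongr
        exact sum_lensAngle_le_pi hR x S hx hS
    _ = fullLensArea R := by field_simp

theorem eq_of_sum_lensArea_eq {R : ℝ} (hR : 0 < R) (x : ℂ) (S : Finset ℂ)
    (hx : ∀ y ∈ S, 2 * R ≤ dist x y)
    (hS : (S : Set ℂ).Pairwise fun y y' => 2 * R ≤ dist y y')
    (h : ∑ y ∈ S, lensArea R (dist x y) = fullLensArea R) :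
    (∀ y ∈ S, dist x y < 2 * circumradius R → dist x y = 2 * R) ∧
      (S.filter fun y => dist x y = 2 * R).card = 6 := by
  have hpi := Real.pi_pos
  have hM := fullLensArea_pos hR
  have h1 : ∀ y ∈ S, lensArea R (dist x y) ≤ fullLensArea R / Real.pi * lensAngle R (dist x y) :=
    fun y hy => lensArea_le hR (hx y hy)
  have h2 := sum_lensAngle_le_pi hR x S hx hS
  have h3 : ∑ y ∈ S, fullLensArea R / Real.pi * lensAngle R (dist x y) ≤ fullLensArea R := by
    rw [← Finset.mul_sum]
    calc _ ≤ fullLensArea R / Real.pi * Real.pi := by gcongr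
      _ = fullLensArea R := by field_simp
  have h4 := (Finset.sum_eq_sum_iff_of_le h1).1 (le_antisymm (Finset.sum_le_sum h1) (by rwa [h]))
  have h5 : ∀ y ∈ S, dist x y < 2 * circumradius R → dist x y = 2 * R := by
    intro y hy hlt
    by_contra hne
    exact (lensArea_lt hR (lt_of_le_of_ne (hx y hy) (Ne.symm hne)) hlt).ne (h4 y hy)
  refine ⟨h5, ?_⟩
  have h6 : ∑ y ∈ S, lensAngle R (dist x y)
      = ∑ y ∈ S.filter (fun y => dist x y = 2 * R), Real.pi / 6 := by
    rw [Finset.sum_filter]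
    refine Finset.sum_congr rfl fun y hy => ?_
    split_ifs with hif
    · rw [hif, lensAngle_two_mul hR]
    · refine le_antisymm (not_lt.1 fun hlt => hif (h5 y hy ((lensAngle_pos_iff hR).1 hlt)))
        (lensAngle_nonneg _ _)
  have h7 : ∑ y ∈ S, lensAngle R (dist x y) = Real.pi := by
    have h8 : fullLensArea R / Real.pi * ∑ y ∈ S, lensAngle R (dist x y) = fullLensArea R := by
      rw [Finset.mul_sum, ← Finset.sum_congr rfl h4, h]
    field_simp at h8
    exact h8
  rw [h6, Finset.sum_const, nsmul_eq_mul] at h7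
  have h9 : ((S.filter fun y => dist x y = 2 * R).card : ℝ) = 6 := by
    field_simp at h7
    linarith
  exact_mod_cast h9

theorem two_mul_card_add_le {α : Type*} [DecidableEq α] (F : Finset α) :
    2 * (F.card : ℝ≥0∞) + 2 * (if F.card = 0 then 1 else 0)
      ≤ 2 + ∑ x ∈ F, ((F.erase x).card : ℝ≥0∞) := by
  have h : ∑ x ∈ F, ((F.erase x).card : ℝ≥0∞) = ((F.card * (F.card - 1) : ℕ) : ℝ≥0∞) := by
    rw [Finset.sum_congr rfl fun x hx => by rw [Finset.card_erase_of_mem hx], Finset.sum_const,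
      nsmul_eq_mul, Nat.cast_mul]
  rw [h]
  have hn : 2 * F.card + 2 * (if F.card = 0 then 1 else 0) ≤ 2 + F.card * (F.card - 1) := by
    rcases hc : F.card with _ | _ | n
    · simp
    · simp
    · simp only [Nat.add_eq_zero_iff, one_ne_zero, and_false, if_false, Nat.add_sub_cancel]
      nlinarith
  exact_mod_cast hn

/-- A Bonferroni inequality. -/
theorem two_mul_sum_measure_add_le {α β : Type*} [MeasurableSpace α] [DecidableEq β]
    (μ : Measure α) (T : Finset β) (D : β → Set α) (hD : ∀ x, MeasurableSet (D x)) {B : Set α}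
    (hB : MeasurableSet B) (hDB : ∀ x ∈ T, D x ⊆ B) :
    2 * ∑ x ∈ T, μ (D x) + 2 * μ (B \ ⋃ x ∈ T, D x)
      ≤ 2 * μ B + ∑ x ∈ T, ∑ y ∈ T.erase x, μ (D x ∩ D y) := by
  classical
  have hZ : MeasurableSet (B \ ⋃ x ∈ T, D x) :=
    hB.diff (T.measurableSet_biUnion fun x _ => hD x)
  have hm : ∀ s : Set α, MeasurableSet s → Measurable (s.indicator (1 : α → ℝ≥0∞)) :=
    fun s hs => measurable_one.indicator hs
  have key : ∀ w, 2 * ∑ x ∈ T, (D x).indicator (1 : α → ℝ≥0∞) w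
      + 2 * (B \ ⋃ x ∈ T, D x).indicator (1 : α → ℝ≥0∞) w
      ≤ 2 * B.indicator (1 : α → ℝ≥0∞) w
        + ∑ x ∈ T, ∑ y ∈ T.erase x, (D x ∩ D y).indicator (1 : α → ℝ≥0∞) w := by
    intro w
    set F := T.filter fun x => w ∈ D x with hF
    by_cases hw : w ∈ B
    · have h1 : ∑ x ∈ T, (D x).indicator (1 : α → ℝ≥0∞) w = F.card := by
        simp [hF, Set.indicator_apply]
      have h2 : (B \ ⋃ x ∈ T, D x).indicator (1 : α → ℝ≥0∞) w = if F.card = 0 then 1 else 0 := by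
        simp [hF, Set.indicator_apply, hw, Finset.filter_eq_empty_iff]
      have h3 : ∑ x ∈ T, ∑ y ∈ T.erase x, (D x ∩ D y).indicator (1 : α → ℝ≥0∞) w
          = ∑ x ∈ F, ((F.erase x).card : ℝ≥0∞) := by
        rw [hF, Finset.sum_filter]
        refine Finset.sum_congr rfl fun x _ => ?_
        split_ifs with hx
        · rw [← Finset.filter_erase]
          simp [Set.indicator_apply, hx]
        · simp [hx]
      rw [h1, h2, h3, Set.indicator_of_mem hw]
      simpa using two_mul_card_add_le F
    · have h1 : ∑ x ∈ T, (D x).indicator (1 : α → ℝ≥0∞) w = 0 :=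
        Finset.sum_eq_zero fun x hx =>
          Set.indicator_of_notMem (fun h => hw (hDB x hx h)) _
      rw [h1, Set.indicator_of_notMem (fun h => hw h.1)]
      simp
  have h := lintegral_mono (μ := μ) key
  rw [lintegral_add_left ((Finset.measurable_sum _ fun x _ => hm _ (hD x)).const_mul 2),
    lintegral_add_left ((hm B hB).const_mul 2), lintegral_const_mul _ (hm _ hZ), lintegral_const_mul _ (hm B hB),
    lintegral_const_mul _ (Finset.measurable_sum _ fun x _ => hm _ (hD x)),
    lintegral_finsetSum _ (fun x _ => hm _ (hD x)),
    lintegral_finsetSum _ (fun x _ => Finset.measurable_sum _ fun y _ =>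
      hm _ ((hD x).inter (hD y)))] at h
  have h4 : ∀ x ∈ T, ∫⁻ w, ∑ y ∈ T.erase x, (D x ∩ D y).indicator (1 : α → ℝ≥0∞) w ∂μ
      = ∑ y ∈ T.erase x, μ (D x ∩ D y) := by
    intro x _
    rw [lintegral_finsetSum _ (fun y _ => hm _ ((hD x).inter (hD y)))]
    exact Finset.sum_congr rfl fun y _ => lintegral_indicator_one ((hD x).inter (hD y))
  rwa [Finset.sum_congr rfl h4, lintegral_indicator_one hZ, lintegral_indicator_one hB,
    Finset.sum_congr rfl fun x _ => lintegral_indicator_one (hD x)] at h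

theorem volume_ball_eq_ofReal (x : ℂ) {r : ℝ} (hr : 0 ≤ r) :
    volume (Metric.ball x r) = ENNReal.ofReal (Real.pi * r ^ 2) := by
  rw [Complex.volume_ball, mul_comm, ENNReal.ofReal_mul Real.pi_pos.le, ENNReal.ofReal_pow hr]
  congr 1
  rw [ENNReal.ofReal, ← NNReal.coe_real_pi, Real.toNNReal_coe]

/-- A finite packing inside a disk: the number of its disks, the area of its holes and the
number of its disks that are not surrounded by six others are bounded by the area. -/
theorem card_add_hole_add_defect_le {R : ℝ} (hR : 0 < R) (T : Finset ℂ) {s : ℝ} (hs : 0 ≤ s)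
    (hT : ∀ x ∈ T, ‖x‖ ≤ s) (hsep : (T : Set ℂ).Pairwise fun x y => 2 * R ≤ dist x y)
    (T' : Finset ℂ) (hT' : T' ⊆ T) {η : ℝ}
    (hη : ∀ x ∈ T', ∑ y ∈ T.erase x, lensArea R (dist x y) ≤ fullLensArea R - η) :
    2 * √3 * R ^ 2 * T.card
      + volume.real (Metric.ball 0 (s + circumradius R) \ ⋃ x ∈ T, Metric.ball x (circumradius R))
      + η / 2 * T'.card ≤ Real.pi * (s + circumradius R) ^ 2 := by
  have hρ := circumradius_pos hR
  have hb := two_mul_sum_measure_add_le volume T (fun x => Metric.ball x (circumradius R))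
    (fun _ => measurableSet_ball) (B := Metric.ball 0 (s + circumradius R)) measurableSet_ball
    (fun x hx => Metric.ball_subset_ball' (by
      rw [dist_zero_right]; linarith [hT x hx]))
  set Z := Metric.ball (0 : ℂ) (s + circumradius R) \ ⋃ x ∈ T, Metric.ball x (circumradius R)
  have hZ : volume Z ≠ ∞ := ((measure_mono Set.sdiff_subset).trans_lt measure_ball_lt_top).ne
  have hlens : ∑ x ∈ T, ∑ y ∈ T.erase x, volume (Metric.ball x (circumradius R)
      ∩ Metric.ball y (circumradius R))
      ≤ ENNReal.ofReal (∑ x ∈ T, ∑ y ∈ T.erase x, lensArea R (dist x y)) := by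
    rw [ENNReal.ofReal_sum_of_nonneg fun x _ => Finset.sum_nonneg fun y _ => lensArea_nonneg _ _]
    refine Finset.sum_le_sum fun x _ => ?_
    rw [ENNReal.ofReal_sum_of_nonneg fun y _ => lensArea_nonneg _ _]
    exact Finset.sum_le_sum fun y hy =>
      volume_ball_inter_ball_le hR (Finset.ne_of_mem_erase hy).symm
  have hfull : ∀ x ∈ T, ∑ y ∈ T.erase x, lensArea R (dist x y) ≤ fullLensArea R := by
    intro x hx
    refine sum_lensArea_le hR x _ (fun y hy => hsep hx (Finset.mem_of_mem_erase hy)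
      (Finset.ne_of_mem_erase hy).symm) (hsep.mono ?_)
    exact_mod_cast Finset.erase_subset x T
  have hsum : ∑ x ∈ T, ∑ y ∈ T.erase x, lensArea R (dist x y)
      ≤ fullLensArea R * T.card - η * T'.card := by
    rw [← Finset.sum_sdiff hT']
    have h1 : ∑ x ∈ T \ T', ∑ y ∈ T.erase x, lensArea R (dist x y)
        ≤ (T \ T').card • fullLensArea R :=
      Finset.sum_le_card_nsmul _ _ _ fun x hx => hfull x (Finset.mem_sdiff.1 hx).1
    have h2 : ∑ x ∈ T', ∑ y ∈ T.erase x, lensArea R (dist x y)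
        ≤ T'.card • (fullLensArea R - η) := Finset.sum_le_card_nsmul _ _ _ hη
    have h3 : ((T \ T').card : ℝ) + T'.card = T.card := by
      exact_mod_cast Finset.card_sdiff_add_card_eq_card hT'
    rw [nsmul_eq_mul] at h1 h2
    rw [← h3]
    nlinarith
  have h0 : 0 ≤ ∑ x ∈ T, ∑ y ∈ T.erase x, lensArea R (dist x y) :=
    Finset.sum_nonneg fun x _ => Finset.sum_nonneg fun y _ => lensArea_nonneg _ _
  have hb' := hb.trans (add_le_add le_rfl hlens)
  simp only [volume_ball_eq_ofReal _ hρ.le, volume_ball_eq_ofReal _ (add_nonneg hs hρ.le),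
    Finset.sum_const, nsmul_eq_mul] at hb'
  have h5 := ENNReal.toReal_mono (by finiteness) hb'
  rw [ENNReal.toReal_add (by finiteness) (by finiteness),
    ENNReal.toReal_add (by finiteness) (by finiteness)] at h5
  simp only [ENNReal.toReal_mul, ENNReal.toReal_ofNat, ENNReal.toReal_natCast,
    ENNReal.toReal_ofReal h0,
    ENNReal.toReal_ofReal (show 0 ≤ Real.pi * circumradius R ^ 2 by positivity),
    ENNReal.toReal_ofReal (show 0 ≤ Real.pi * (s + circumradius R) ^ 2 by positivity)] at h5
  rw [← pi_mul_circumradius_sq_sub, measureReal_def]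
  nlinarith

namespace RigidMotion

/-- The translation by `w`. -/
noncomputable def translation (w : ℂ) : RigidMotion := ⟨1, w⟩

theorem translation_smul (w z : ℂ) : translation w • z = z + w := by
  simp [translation, smul_def]

theorem continuous_translation : Continuous translation :=
  homeoProd.symm.continuous.comp (continuous_const.prodMk continuous_id)

end RigidMotion

namespace DiskPacking

variable {R : ℝ}

theorem mem_translation_smul {P : DiskPacking R} {w z : ℂ} :
    z ∈ (RigidMotion.translation w • P).centers ↔ z - w ∈ P.centers := by
  constructor
  · rintro ⟨x, hx, rfl⟩
    simpa [RigidMotion.translation_smul] using hx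
  · intro h
    exact ⟨z - w, h, by simp [RigidMotion.translation_smul]⟩

instance : MeasurableSMul RigidMotion (DiskPacking R) where
  measurable_const_smul g := (continuous_const_smul g).measurable
  measurable_smul_const _ := (continuous_id.smul continuous_const).measurable

theorem measure_mul_volume_eq_lintegral {μ : Measure (DiskPacking R)}
    (hμ : IsInvariantProbability μ) {E : Set (DiskPacking R)} (hE : MeasurableSet E) (B : Set ℂ) :
    μ E * volume B
      = ∫⁻ Q, volume.restrict B {w | RigidMotion.translation (-w) • Q ∈ E} ∂μ := by
  have := hμ.1
  have := hμ.2
  have hc : Continuous fun p : DiskPacking R × ℂ => RigidMotion.translation (-p.2) • p.1 :=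
    (RigidMotion.continuous_translation.comp continuous_snd.neg).smul continuous_fst
  have hm : MeasurableSet {p : DiskPacking R × ℂ | RigidMotion.translation (-p.2) • p.1 ∈ E} :=
    hc.measurable hE
  have h1 := Measure.prod_apply (μ := μ) (ν := volume.restrict B) hm
  have h2 := Measure.prod_apply_symm (μ := μ) (ν := volume.restrict B) hm
  have h3 : ∀ w, μ ((fun Q => (Q, w)) ⁻¹' {p : DiskPacking R × ℂ |
      RigidMotion.translation (-p.2) • p.1 ∈ E}) = μ E := fun w =>
    measure_preimage_smul_of_nullMeasurableSet hE.nullMeasurableSet (RigidMotion.translation (-w))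
  simp only [h3, lintegral_const, Measure.restrict_apply_univ] at h2
  rw [← h2, h1]
  rfl

/-- If a pointwise bound on the covered area and on the area where an event occurs holds in all
large disks, it holds for probabilities. -/
theorem density_add_measure_le_one {μ : Measure (DiskPacking R)} (hR : 0 < R)
    (hμ : IsInvariantProbability μ) {E : Set (DiskPacking R)} (hE : MeasurableSet E)
    {a b r₁ : ℝ} (hr₁ : 0 ≤ r₁)
    (h : ∀ (Q : DiskPacking R) (r : ℝ), 0 < r →
      ENNReal.ofReal a * volume.restrict (Metric.ball 0 r)
          {w | (0 : ℂ) ∈ (RigidMotion.translation (-w) • Q).covered}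
        + ENNReal.ofReal b * volume.restrict (Metric.ball 0 r)
          {w | RigidMotion.translation (-w) • Q ∈ E}
        ≤ ENNReal.ofReal (Real.pi * (r + r₁) ^ 2)) :
    ENNReal.ofReal a * density μ + ENNReal.ofReal b * μ E ≤ 1 := by
  have := hμ.1
  have hcov : MeasurableSet {P : DiskPacking R | (0 : ℂ) ∈ P.covered} :=
    (isClosed_zero_mem_covered hR).measurableSet
  have hbound : ∀ r : ℝ, 0 < r → ENNReal.ofReal a * density μ + ENNReal.ofReal b * μ E
      ≤ ENNReal.ofReal ((1 + r₁ / r) ^ 2) := by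
    intro r hr
    have h1 : (ENNReal.ofReal a * density μ + ENNReal.ofReal b * μ E) *
        volume (Metric.ball (0 : ℂ) r) ≤ ENNReal.ofReal (Real.pi * (r + r₁) ^ 2) := by
      rw [add_mul, mul_assoc, mul_assoc, density, measure_mul_volume_eq_lintegral hμ hcov,
        measure_mul_volume_eq_lintegral hμ hE, ← lintegral_const_mul' _ _ ENNReal.ofReal_ne_top,
        ← lintegral_const_mul' _ _ ENNReal.ofReal_ne_top]
      refine (le_lintegral_add _ _).trans ?_
      refine (lintegral_mono (h · r hr)).trans ?_
      simp
    have h2 : Real.pi * (r + r₁) ^ 2 = (1 + r₁ / r) ^ 2 * (Real.pi * r ^ 2) := by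
      field_simp
    rw [volume_ball_eq_ofReal 0 hr.le, h2,
      ENNReal.ofReal_mul (p := (1 + r₁ / r) ^ 2) (by positivity)] at h1
    exact (ENNReal.mul_le_mul_iff_left (by simp; positivity) ENNReal.ofReal_ne_top).1 h1
  have hlim : Tendsto (fun r : ℝ => ENNReal.ofReal ((1 + r₁ / r) ^ 2)) atTop (𝓝 1) := by
    have : Tendsto (fun r : ℝ => (1 + r₁ / r) ^ 2) atTop (𝓝 ((1 + 0) ^ 2)) :=
      ((tendsto_const_nhds.div_atTop tendsto_id).const_add 1).pow 2
    simpa using ENNReal.tendsto_ofReal this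
  exact ge_of_tendsto hlim ((eventually_gt_atTop 0).mono hbound)

theorem volume_covered_le (hR : 0 < R) (Q : DiskPacking R) {r s : ℝ} (hs : r + R ≤ s) :
    volume.restrict (Metric.ball 0 r) {w | (0 : ℂ) ∈ (RigidMotion.translation (-w) • Q).covered}
      ≤ ENNReal.ofReal (Real.pi * R ^ 2 *
        (Q.finite_centers_inter_closedBall hR 0 s).toFinset.card) := by
  set T := (Q.finite_centers_inter_closedBall hR 0 s).toFinset with hT
  rw [Measure.restrict_apply' measurableSet_ball]
  calc _ ≤ volume (⋃ x ∈ T, Metric.closedBall x R) := by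
        refine measure_mono ?_
        rintro w ⟨hw, hwr⟩
        obtain ⟨x, hx, hd⟩ := mem_covered.1 hw
        rw [mem_translation_smul, sub_neg_eq_add] at hx
        rw [dist_zero_left] at hd
        rw [mem_ball_zero_iff] at hwr
        refine Set.mem_biUnion (x := x + w) ?_ ?_
        · simp only [hT, Set.Finite.coe_toFinset]
          refine ⟨hx, ?_⟩
          rw [mem_closedBall_zero_iff]
          linarith [norm_add_le x w]
        · simpa [Metric.mem_closedBall, dist_eq_norm] using hd
    _ ≤ ∑ x ∈ T, volume (Metric.closedBall x R) := measure_biUnion_finset_le _ _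
    _ = _ := by
        have h1 : ∀ x ∈ T, volume (Metric.closedBall x R) = ENNReal.ofReal (Real.pi * R ^ 2) := by
          intro x _
          rw [Complex.volume_closedBall, ← Complex.volume_ball x R, volume_ball_eq_ofReal x hR.le]
        rw [Finset.sum_congr rfl h1, Finset.sum_const, nsmul_eq_mul, mul_comm (Real.pi * R ^ 2),
          ENNReal.ofReal_mul (Nat.cast_nonneg _), ENNReal.ofReal_natCast]

/-- The reciprocal of the greatest density. -/
noncomputable def inverseDensity : ℝ := 2 * √3 / Real.pi

/-- A packing that leaves a hole at the origin. -/
def HasHole (Q : DiskPacking R) : Prop := ∀ x ∈ Q.centers, circumradius R ≤ ‖x‖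

/-- The centre `x` of `Q` is not surrounded by six disks, by a margin `η`. -/
def IsDefect (Q : DiskPacking R) (η : ℝ) (x : ℂ) : Prop :=
  ∀ S : Finset ℂ, (∀ y ∈ S, y ∈ Q.centers ∧ y ≠ x) →
    ∑ y ∈ S, lensArea R (dist x y) ≤ fullLensArea R - η

theorem covered_add_hole_le (hR : 0 < R) (Q : DiskPacking R) {r : ℝ} (hr : 0 < r) :
    ENNReal.ofReal inverseDensity * volume.restrict (Metric.ball 0 r)
          {w | (0 : ℂ) ∈ (RigidMotion.translation (-w) • Q).covered}
        + ENNReal.ofReal 1 * volume.restrict (Metric.ball 0 r)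
          {w | RigidMotion.translation (-w) • Q ∈ {Q : DiskPacking R | Q.HasHole}}
        ≤ ENNReal.ofReal (Real.pi * (r + (R + circumradius R)) ^ 2) := by
  have hρ := circumradius_pos hR
  have hpi := Real.pi_pos
  set T := (Q.finite_centers_inter_closedBall hR 0 (r + R)).toFinset with hT
  have hTmem : ∀ x, x ∈ T ↔ x ∈ Q.centers ∧ ‖x‖ ≤ r + R := by
    intro x; simp [hT]
  have hmain := card_add_hole_add_defect_le hR T (s := r + R) (by linarith)
    (fun x hx => ((hTmem x).1 hx).2)
    (fun x hx y hy hxy => Q.two_mul_le_dist hR ((hTmem x).1 hx).1 ((hTmem y).1 hy).1 hxy)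
    ∅ (Finset.empty_subset _) (η := 0) (by simp)
  have hhole : volume.restrict (Metric.ball 0 r)
      {w | RigidMotion.translation (-w) • Q ∈ {Q : DiskPacking R | Q.HasHole}}
      ≤ volume (Metric.ball (0 : ℂ) (r + R + circumradius R)
        \ ⋃ x ∈ T, Metric.ball x (circumradius R)) := by
    rw [Measure.restrict_apply' measurableSet_ball]
    refine measure_mono ?_
    rintro w ⟨hw, hwr⟩
    refine ⟨Metric.ball_subset_ball (by linarith) hwr, ?_⟩
    simp only [Set.mem_iUnion, not_exists]
    intro x hx hwx
    have h1 := hw (x - w) (mem_translation_smul.2 (by simpa using ((hTmem x).1 hx).1))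
    rw [mem_ball_iff_norm'] at hwx
    linarith
  refine (add_le_add (mul_le_mul_right (volume_covered_le hR Q (s := r + R) le_rfl) _)
    (mul_le_mul_right hhole _)).trans ?_
  have hfin : volume (Metric.ball (0 : ℂ) (r + R + circumradius R)
        \ ⋃ x ∈ T, Metric.ball x (circumradius R)) ≠ ∞ :=
    ((measure_mono Set.sdiff_subset).trans_lt measure_ball_lt_top).ne
  rw [← ENNReal.ofReal_mul (by unfold inverseDensity; positivity),
    ← ENNReal.ofReal_toReal hfin, ← ENNReal.ofReal_mul one_pos.le, ← ENNReal.ofReal_add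
    (by unfold inverseDensity; positivity) (by positivity)]
  refine ENNReal.ofReal_le_ofReal ?_
  have h2 : inverseDensity * (Real.pi * R ^ 2 * T.card) = 2 * √3 * R ^ 2 * T.card := by
    unfold inverseDensity; field_simp
  rw [h2, ← measureReal_def]
  simp only [Finset.card_empty, Nat.cast_zero, mul_zero, add_zero] at hmain
  rw [one_mul, ← add_assoc r]
  exact hmain

theorem IsDefect.of_translation {Q : DiskPacking R} {η : ℝ} {x w : ℂ}
    (h : (RigidMotion.translation (-w) • Q).IsDefect η x) : Q.IsDefect η (x + w) := by
  intro S hS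
  have h1 := h (S.map (Equiv.subRight w).toEmbedding) (by
    intro y hy
    obtain ⟨z, hz, rfl⟩ := Finset.mem_map.1 hy
    refine ⟨mem_translation_smul.2 (by simpa using (hS z hz).1), ?_⟩
    rintro rfl
    exact (hS z hz).2 (by simp))
  rw [Finset.sum_map] at h1
  refine le_trans (le_of_eq (Finset.sum_congr rfl fun y _ => ?_)) h1
  congr 1
  simp only [dist_eq_norm, Equiv.coe_toEmbedding, Equiv.subRight_apply]
  congr 1
  ring

theorem covered_add_defect_le (hR : 0 < R) (Q : DiskPacking R) {η : ℝ} (hη : 0 < η) (c : ℂ)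
    {r : ℝ} (hr : 0 < r) :
    ENNReal.ofReal inverseDensity * volume.restrict (Metric.ball 0 r)
          {w | (0 : ℂ) ∈ (RigidMotion.translation (-w) • Q).covered}
        + ENNReal.ofReal (η / (2 * (Real.pi * R ^ 2))) * volume.restrict (Metric.ball 0 r)
          {w | RigidMotion.translation (-w) • Q ∈
            {Q : DiskPacking R | ∃ x ∈ Q.centers, dist x c < R ∧ Q.IsDefect η x}}
        ≤ ENNReal.ofReal (Real.pi * (r + (R + ‖c‖ + circumradius R)) ^ 2) := by
  classical
  have hρ := circumradius_pos hR
  have hpi := Real.pi_pos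
  set s := r + R + ‖c‖ with hs
  set T := (Q.finite_centers_inter_closedBall hR 0 s).toFinset with hT
  have hTmem : ∀ x, x ∈ T ↔ x ∈ Q.centers ∧ ‖x‖ ≤ s := by
    intro x; simp [hT]
  set T' := T.filter fun x => Q.IsDefect η x with hT'
  have hmain := card_add_hole_add_defect_le hR T (s := s) (by positivity)
    (fun x hx => ((hTmem x).1 hx).2)
    (fun x hx y hy hxy => Q.two_mul_le_dist hR ((hTmem x).1 hx).1 ((hTmem y).1 hy).1 hxy)
    T' (Finset.filter_subset _ _) (η := η) (fun x hx => (Finset.mem_filter.1 hx).2 _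
      fun y hy => ⟨((hTmem y).1 (Finset.mem_of_mem_erase hy)).1, Finset.ne_of_mem_erase hy⟩)
  have hdef : volume.restrict (Metric.ball 0 r)
      {w | RigidMotion.translation (-w) • Q ∈
        {Q : DiskPacking R | ∃ x ∈ Q.centers, dist x c < R ∧ Q.IsDefect η x}}
      ≤ ENNReal.ofReal (Real.pi * R ^ 2 * T'.card) := by
    rw [Measure.restrict_apply' measurableSet_ball]
    calc _ ≤ volume (⋃ x ∈ T', Metric.ball (x - c) R) := by
          refine measure_mono ?_
          rintro w ⟨⟨x, hx, hxc, hxd⟩, hwr⟩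
          rw [mem_translation_smul, sub_neg_eq_add] at hx
          rw [mem_ball_zero_iff] at hwr
          rw [dist_eq_norm] at hxc
          refine Set.mem_biUnion (x := x + w) ?_ ?_
          · refine Finset.mem_coe.2 (Finset.mem_filter.2 ⟨(hTmem _).2 ⟨hx, ?_⟩, hxd.of_translation⟩)
            have h1 : x + w = (x - c) + c + w := by ring
            rw [h1]
            have h2 := norm_add_le (x - c + c) w
            have h3 := norm_add_le (x - c) c
            linarith
          · rw [mem_ball_iff_norm']
            have h1 : x + w - c - w = x - c := by ring
            rwa [h1]
      _ ≤ ∑ x ∈ T', volume (Metric.ball (x - c) R) := measure_biUnion_finset_le _ _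
      _ = _ := by
          rw [Finset.sum_congr rfl fun x _ => volume_ball_eq_ofReal (x - c) hR.le,
            Finset.sum_const, nsmul_eq_mul, mul_comm (Real.pi * R ^ 2),
            ENNReal.ofReal_mul (Nat.cast_nonneg _), ENNReal.ofReal_natCast]
  refine (add_le_add (mul_le_mul_right (volume_covered_le hR Q (s := s)
    (by linarith [norm_nonneg c])) _) (mul_le_mul_right hdef _)).trans ?_
  rw [← ENNReal.ofReal_mul (by unfold inverseDensity; positivity),
    ← ENNReal.ofReal_mul (by positivity), ← ENNReal.ofReal_add
    (by unfold inverseDensity; positivity) (by positivity)]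
  refine ENNReal.ofReal_le_ofReal ?_
  have h2 : inverseDensity * (Real.pi * R ^ 2 * T.card) = 2 * √3 * R ^ 2 * T.card := by
    unfold inverseDensity; field_simp
  have h3 : η / (2 * (Real.pi * R ^ 2)) * (Real.pi * R ^ 2 * T'.card) = η / 2 * T'.card := by
    field_simp
  have h4 : r + (R + ‖c‖ + circumradius R) = s + circumradius R := by rw [hs]; ring
  rw [h2, h3, h4]
  refine le_trans ?_ hmain
  linarith [measureReal_nonneg (μ := (volume : Measure ℂ)) (s := Metric.ball 0 (s + circumradius R)
    \ ⋃ x ∈ T, Metric.ball x (circumradius R))]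

end DiskPacking

/-- The primitive sixth root of unity in the upper half plane. -/
noncomputable def sixthRoot : ℂ := 1 / 2 + (√3 / 2 : ℝ) * Complex.I

theorem sixthRoot_re : sixthRoot.re = 1 / 2 := by simp [sixthRoot]

theorem sixthRoot_im : sixthRoot.im = √3 / 2 := by simp [sixthRoot]

theorem sixthRoot_sq : sixthRoot ^ 2 = sixthRoot - 1 := by
  have h3 : √3 * √3 = 3 := Real.mul_self_sqrt (by norm_num)
  apply Complex.ext
  · rw [pow_two, Complex.mul_re, Complex.sub_re, sixthRoot_re, sixthRoot_im, Complex.one_re]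
    linarith
  · rw [pow_two, Complex.mul_im, Complex.sub_im, sixthRoot_re, sixthRoot_im, Complex.one_im]
    ring

theorem sixthRoot_pow_three : sixthRoot ^ 3 = -1 := by
  linear_combination (sixthRoot + 1) * sixthRoot_sq

theorem norm_sixthRoot : ‖sixthRoot‖ = 1 := by
  have h3 : √3 * √3 = 3 := Real.mul_self_sqrt (by norm_num)
  rw [← sq_eq_sq₀ (norm_nonneg _) zero_le_one, Complex.sq_norm, Complex.normSq_apply, sixthRoot_re,
    sixthRoot_im]
  linarith

/-- Every point is at distance less than one from a point of the triangular lattice. -/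
theorem exists_norm_sub_lattice_lt (q : ℂ) : ∃ a b : ℤ, ‖q - (a + b * sixthRoot)‖ < 1 := by
  have h3 : √3 * √3 = 3 := Real.mul_self_sqrt (by norm_num)
  have h3' : √3 ≠ 0 := by positivity
  set t := q.im / (√3 / 2) with ht
  have him : q.im = t * (√3 / 2) := by rw [ht]; field_simp
  set s := q.re - t / 2 with hs
  have hre : q.re = s + t / 2 := by rw [hs]; ring
  refine ⟨round s, round t, ?_⟩
  have h1 := abs_le.1 (abs_sub_round s)
  have h2 := abs_le.1 (abs_sub_round t)
  rw [← sq_lt_sq₀ (norm_nonneg _) zero_le_one, Complex.sq_norm, Complex.normSq_apply]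
  simp only [Complex.sub_re, Complex.add_re, Complex.mul_re, Complex.intCast_re,
    Complex.intCast_im, Complex.sub_im, Complex.add_im, Complex.mul_im, sixthRoot_re, sixthRoot_im,
    hre, him]
  set x := s - round s
  set y := t - round t
  have e : (s + t / 2 - (round s + (round t * (1 / 2) - 0 * (√3 / 2)))) *
      (s + t / 2 - (round s + (round t * (1 / 2) - 0 * (√3 / 2)))) +
      (t * (√3 / 2) - (0 + (round t * (√3 / 2) + 0 * (1 / 2)))) *
      (t * (√3 / 2) - (0 + (round t * (√3 / 2) + 0 * (1 / 2)))) = x ^ 2 + x * y + y ^ 2 := by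
    simp only [x, y]
    linear_combination ((t - round t) ^ 2 / 4) * h3
  rw [e]
  nlinarith [h1.1, h1.2, h2.1, h2.2, sq_nonneg (x - y), sq_nonneg (x + y)]

theorem sum_sum_re_pow_nonneg (S : Finset ℂ) (k : ℕ) :
    0 ≤ ∑ v ∈ S, ∑ w ∈ S, ((v * (starRingEnd ℂ) w) ^ k).re := by
  have h : ∑ v ∈ S, ∑ w ∈ S, ((v * (starRingEnd ℂ) w) ^ k).re
      = ((∑ v ∈ S, v ^ k) * (starRingEnd ℂ) (∑ v ∈ S, v ^ k)).re := by
    rw [map_sum, Finset.sum_mul_sum]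
    simp only [Complex.re_sum, map_pow, mul_pow]
  rw [h, Complex.mul_conj, Complex.ofReal_re]
  exact Complex.normSq_nonneg _

/-- The polynomial of the linear programming bound for six points on the circle. -/
theorem linearProgramming_poly {z : ℂ} (hz : ‖z‖ = 1) :
    (z.re - 1 / 2) * (z.re + 1 / 2) ^ 2 * (z.re + 1)
      = 3 / 8 + 3 / 4 * (z ^ 1).re + 5 / 8 * (z ^ 2).re + 3 / 8 * (z ^ 3).re
        + 1 / 8 * (z ^ 4).re := by
  have h : z.re ^ 2 + z.im ^ 2 = 1 := by
    have := Complex.sq_norm z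
    rw [hz, Complex.normSq_apply] at this
    linarith
  have e2 : (z ^ 2).re = 2 * z.re ^ 2 - 1 := by
    simp only [pow_two, Complex.mul_re]
    linear_combination -h
  have e3 : (z ^ 3).re = 4 * z.re ^ 3 - 3 * z.re := by
    simp only [pow_succ, pow_zero, one_mul, Complex.mul_re, Complex.mul_im]
    linear_combination (-3 * z.re) * h
  have e4 : (z ^ 4).re = 8 * z.re ^ 4 - 8 * z.re ^ 2 + 1 := by
    simp only [pow_succ, pow_zero, one_mul, Complex.mul_re, Complex.mul_im]
    linear_combination (z.im ^ 2 - 7 * z.re ^ 2 + 1) * h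
  rw [e2, e3, e4, pow_one]
  ring

theorem mem_rotations_of_re {z : ℂ} (hz : ‖z‖ = 1)
    (h : (z.re - 1 / 2) * (z.re + 1 / 2) ^ 2 * (z.re + 1) = 0) :
    ∃ k : ℕ, k < 6 ∧ z = sixthRoot ^ k := by
  have h3 : √3 * √3 = 3 := Real.mul_self_sqrt (by norm_num)
  have hn : z.re ^ 2 + z.im ^ 2 = 1 := by
    have := Complex.sq_norm z
    rw [hz, Complex.normSq_apply] at this
    linarith
  have h4 : sixthRoot ^ 4 = -sixthRoot := by linear_combination sixthRoot * sixthRoot_pow_three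
  have h5 : sixthRoot ^ 5 = 1 - sixthRoot := by
    linear_combination sixthRoot ^ 2 * sixthRoot_pow_three - sixthRoot_sq
  have him : ∀ {c : ℝ}, z.im ^ 2 = c ^ 2 → z.im = c ∨ z.im = -c :=
    fun h => sq_eq_sq_iff_eq_or_eq_neg.1 h
  rcases mul_eq_zero.1 h with h | h
  · rcases mul_eq_zero.1 h with h | h
    · have hre : z.re = 1 / 2 := by linarith
      rcases him (c := √3 / 2) (by rw [hre] at hn; nlinarith) with h6 | h6
      · exact ⟨1, by norm_num, Complex.ext (by rw [pow_one, hre, sixthRoot_re])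
          (by rw [pow_one, h6, sixthRoot_im])⟩
      · refine ⟨5, by norm_num, Complex.ext ?_ ?_⟩
        · rw [h5, hre, Complex.sub_re, sixthRoot_re, Complex.one_re]; norm_num
        · rw [h5, h6, Complex.sub_im, sixthRoot_im, Complex.one_im]; ring
    · have hre : z.re = -1 / 2 := by
        have := pow_eq_zero_iff (two_ne_zero) |>.1 h
        linarith
      rcases him (c := √3 / 2) (by rw [hre] at hn; nlinarith) with h6 | h6
      · refine ⟨2, by norm_num, Complex.ext ?_ ?_⟩
        · rw [sixthRoot_sq, hre, Complex.sub_re, sixthRoot_re, Complex.one_re]; norm_num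
        · rw [sixthRoot_sq, h6, Complex.sub_im, sixthRoot_im, Complex.one_im]; ring
      · refine ⟨4, by norm_num, Complex.ext ?_ ?_⟩
        · rw [h4, hre, Complex.neg_re, sixthRoot_re]; norm_num
        · rw [h4, h6, Complex.neg_im, sixthRoot_im]
  · have hre : z.re = -1 := by linarith
    refine ⟨3, by norm_num, Complex.ext ?_ ?_⟩
    · rw [sixthRoot_pow_three, hre]; simp
    · rw [sixthRoot_pow_three]
      rw [hre] at hn
      have : z.im = 0 := by nlinarith
      simpa using this

/-- Six points of the unit circle at mutual distances at least one form a regular hexagon. -/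
theorem mul_sixthRoot_mem {S : Finset ℂ} (hcard : S.card = 6) (hunit : ∀ v ∈ S, ‖v‖ = 1)
    (hsep : (S : Set ℂ).Pairwise fun v w => 1 ≤ dist v w) {v : ℂ} (hv : v ∈ S) :
    v * sixthRoot ∈ S := by
  set f : ℂ → ℂ → ℝ := fun v w => ((v * (starRingEnd ℂ) w).re - 1 / 2)
    * ((v * (starRingEnd ℂ) w).re + 1 / 2) ^ 2 * ((v * (starRingEnd ℂ) w).re + 1) with hf
  have hnorm : ∀ v ∈ S, ∀ w ∈ S, ‖v * (starRingEnd ℂ) w‖ = 1 := by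
    intro v hv w hw
    rw [norm_mul, RCLike.norm_conj, hunit v hv, hunit w hw, one_mul]
  have hle : ∀ v ∈ S, ∀ w ∈ S, f v w ≤ if v = w then 9 / 4 else 0 := by
    intro v hv w hw
    split_ifs with h
    · subst h
      have h1 : (v * (starRingEnd ℂ) v).re = 1 := by
        rw [Complex.mul_conj, Complex.ofReal_re, Complex.normSq_eq_norm_sq, hunit v hv, one_pow]
      simp only [hf, h1]
      norm_num
    · have h1 : (v * (starRingEnd ℂ) w).re ≤ 1 / 2 := by
        have h2 := hsep hv hw h
        have h3 : (1 : ℝ) ≤ dist v w ^ 2 := by nlinarith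
        have e1 := Complex.sq_norm v
        have e2 := Complex.sq_norm w
        rw [hunit v hv, Complex.normSq_apply] at e1
        rw [hunit w hw, Complex.normSq_apply] at e2
        rw [dist_eq_norm, Complex.sq_norm, Complex.normSq_apply, Complex.sub_re,
          Complex.sub_im] at h3
        simp only [Complex.mul_re, Complex.conj_re, Complex.conj_im]
        nlinarith
      have h2 : -1 ≤ (v * (starRingEnd ℂ) w).re := by
        have := Complex.abs_re_le_norm (v * (starRingEnd ℂ) w)
        rw [hnorm v hv w hw] at this
        exact (abs_le.1 this).1
      simp only [hf]
      exact mul_nonpos_of_nonpos_of_nonneg (mul_nonpos_of_nonpos_of_nonneg (by linarith)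
        (sq_nonneg _)) (by linarith)
  have hsum_le : ∑ v ∈ S, ∑ w ∈ S, (if v = w then (9 / 4 : ℝ) else 0) = 27 / 2 := by
    have : ∀ v ∈ S, ∑ w ∈ S, (if v = w then (9 / 4 : ℝ) else 0) = 9 / 4 := by
      intro v hv
      rw [Finset.sum_ite_eq, if_pos hv]
    rw [Finset.sum_congr rfl this, Finset.sum_const, hcard]
    norm_num
  have hsum_ge : (27 / 2 : ℝ) ≤ ∑ v ∈ S, ∑ w ∈ S, f v w := by
    have h1 : ∑ v ∈ S, ∑ w ∈ S, f v w = ∑ v ∈ S, ∑ w ∈ S, (3 / 8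
        + 3 / 4 * ((v * (starRingEnd ℂ) w) ^ 1).re + 5 / 8 * ((v * (starRingEnd ℂ) w) ^ 2).re
        + 3 / 8 * ((v * (starRingEnd ℂ) w) ^ 3).re + 1 / 8 * ((v * (starRingEnd ℂ) w) ^ 4).re) :=
      Finset.sum_congr rfl fun v hv => Finset.sum_congr rfl fun w hw =>
        linearProgramming_poly (hnorm v hv w hw)
    rw [h1]
    simp only [Finset.sum_add_distrib, ← Finset.mul_sum, Finset.sum_const, hcard]
    have := sum_sum_re_pow_nonneg S 1
    have := sum_sum_re_pow_nonneg S 2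
    have := sum_sum_re_pow_nonneg S 3
    have := sum_sum_re_pow_nonneg S 4
    norm_num at *
    linarith
  have hrow : ∀ v ∈ S, ∑ w ∈ S, f v w = ∑ w ∈ S, (if v = w then (9 / 4 : ℝ) else 0) := by
    refine (Finset.sum_eq_sum_iff_of_le fun v hv => Finset.sum_le_sum (hle v hv)).1 ?_
    refine le_antisymm (Finset.sum_le_sum fun v hv => Finset.sum_le_sum (hle v hv)) ?_
    rw [hsum_le]; exact hsum_ge
  have hzero : ∀ w ∈ S, ∃ k : ℕ, k < 6 ∧ w = v * sixthRoot ^ k := by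
    intro w hw
    by_cases hvw : w = v
    · exact ⟨0, by norm_num, by simp [hvw]⟩
    have h1 := (Finset.sum_eq_sum_iff_of_le (hle w hw)).1 (hrow w hw) v hv
    rw [if_neg hvw] at h1
    obtain ⟨k, hk, hk'⟩ := mem_rotations_of_re (hnorm w hw v hv) h1
    refine ⟨k, hk, ?_⟩
    rw [← hk', mul_comm w, ← mul_assoc, Complex.mul_conj, Complex.normSq_eq_norm_sq, hunit v hv]
    simp
  have hsub : S ⊆ (Finset.range 6).image fun k => v * sixthRoot ^ k := by
    intro w hw
    obtain ⟨k, hk, rfl⟩ := hzero w hw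
    exact Finset.mem_image_of_mem _ (Finset.mem_range.2 hk)
  have heq := Finset.eq_of_subset_of_card_le hsub (by
    rw [hcard]
    exact Finset.card_image_le.trans (by simp))
  rw [heq]
  exact Finset.mem_image.2 ⟨1, by simp, by simp⟩

namespace DiskPacking

variable {R : ℝ}

theorem hasHole_mem_nhds (hR : 0 < R) {P : DiskPacking R} (hP : P.centers = ∅) :
    {Q : DiskPacking R | Q.HasHole} ∈ 𝓝 P := by
  have hρ := circumradius_pos hR
  refine mem_nhds_iff_close.2 ⟨1 / circumradius R, by positivity, fun Q hQ x hx => ?_⟩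
  by_contra! h
  obtain ⟨y, hy, -⟩ := hQ.2 x hx (by rw [one_div_one_div]; exact h.le)
  rw [hP] at hy
  exact hy

theorem lensArea_eq_zero (hR : 0 < R) {d : ℝ} (hd : 2 * circumradius R ≤ d) :
    lensArea R d = 0 := by
  have h : lensAngle R d = 0 := le_antisymm
    (not_lt.1 fun h => absurd ((lensAngle_pos_iff hR).1 h) (not_lt.2 hd)) (lensAngle_nonneg R d)
  simp [lensArea, h]

/-- The centres other than `x` at distance at most `2 * circumradius R + 1` from `x`. -/
noncomputable def nearCenters (hR : 0 < R) (P : DiskPacking R) (x : ℂ) : Finset ℂ :=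
  (P.finite_centers_inter_closedBall hR x (2 * circumradius R + 1)).toFinset.erase x

theorem mem_nearCenters (hR : 0 < R) {P : DiskPacking R} {x y : ℂ} :
    y ∈ P.nearCenters hR x ↔ y ≠ x ∧ y ∈ P.centers ∧ dist x y ≤ 2 * circumradius R + 1 := by
  simp [nearCenters, dist_comm]

theorem isDefect_mem_nhds (hR : 0 < R) {P : DiskPacking R} {x : ℂ} (hx : x ∈ P.centers) {η : ℝ}
    (hη : 0 < η)
    (h : ∑ y ∈ P.nearCenters hR x, lensArea R (dist x y) ≤ fullLensArea R - 2 * η) :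
    {Q : DiskPacking R | ∃ z ∈ Q.centers, dist z x < R ∧ Q.IsDefect η z} ∈ 𝓝 P := by
  classical
  have hρ := circumradius_pos hR
  set S₀ := P.nearCenters hR x with hS₀
  set κ := η / (S₀.card + 1) with hκ
  have hκ0 : 0 < κ := by positivity
  have hev : ∀ᶠ δ in 𝓝[>] (0 : ℝ), ∀ y ∈ S₀, ∀ d : ℝ, |d - dist x y| ≤ 2 * δ →
      lensArea R d ≤ lensArea R (dist x y) + κ := by
    refine (S₀.finite_toSet.eventually_all (p := fun y δ => ∀ d : ℝ, |d - dist x y| ≤ 2 * δ →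
      lensArea R d ≤ lensArea R (dist x y) + κ)).2 fun y _ => ?_
    obtain ⟨δ, hδ, h1⟩ := Metric.continuousAt_iff.1
      ((continuous_lensArea R).continuousAt (x := dist x y)) κ hκ0
    have h2 : ∀ᶠ δ' in 𝓝[>] (0 : ℝ), δ' < δ / 2 :=
      nhdsWithin_le_nhds (gt_mem_nhds (by linarith))
    filter_upwards [h2] with δ' hδ' d hd
    have h3 := h1 (x := d) (by rw [Real.dist_eq]; linarith)
    rw [Real.dist_eq] at h3
    linarith [(abs_lt.1 h3).2]
  obtain ⟨ε, ⟨⟨hε1, hε2⟩, hε3⟩, hε4⟩ : ∃ ε : ℝ, (((∀ y ∈ S₀, ∀ d : ℝ,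
      |d - dist x y| ≤ 2 * ε → lensArea R d ≤ lensArea R (dist x y) + κ) ∧ ε < 1 / 2) ∧
      (ε < R ∧ ε < 1 / (‖x‖ + 2 * circumradius R + 1))) ∧ 0 < ε := by
    have h1 : ∀ c : ℝ, 0 < c → ∀ᶠ δ in 𝓝[>] (0 : ℝ), δ < c :=
      fun c hc => nhdsWithin_le_nhds (gt_mem_nhds hc)
    exact (((hev.and (h1 _ (by norm_num))).and ((h1 R hR).and (h1 _ (by positivity)))).and
      self_mem_nhdsWithin).exists
  have hB : ‖x‖ + 2 * circumradius R + 1 ≤ 1 / ε := by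
    have := hε3.2
    rw [lt_div_iff₀ (by positivity)] at this
    rw [le_div_iff₀ hε4]
    linarith
  refine mem_nhds_iff_close.2 ⟨ε, hε4, fun Q hQ => ?_⟩
  obtain ⟨z, hz, hxz⟩ := hQ.1 x hx (by linarith)
  refine ⟨z, hz, by rw [dist_comm]; linarith, fun S hS => ?_⟩
  have hznorm : ‖z‖ ≤ ‖x‖ + dist x z := by
    rw [dist_eq_norm]; exact norm_le_norm_add_norm_sub x z
  have hmatch : ∀ y ∈ S.filter (fun y => dist z y < 2 * circumradius R),
      ∃ y' ∈ P.centers, dist y' y ≤ ε := by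
    intro y hy
    obtain ⟨hyS, hyd⟩ := Finset.mem_filter.1 hy
    refine hQ.2 y (hS y hyS).1 ?_
    have : ‖y‖ ≤ ‖z‖ + dist z y := by
      rw [dist_eq_norm]; exact norm_le_norm_add_norm_sub z y
    linarith
  choose! m hmP hmd using hmatch
  have hdist : ∀ y ∈ S.filter (fun y => dist z y < 2 * circumradius R),
      |dist z y - dist x (m y)| ≤ 2 * ε := by
    intro y hy
    have h1 := dist_dist_dist_le z y x (m y)
    rw [Real.dist_eq, dist_comm z x, dist_comm y] at h1
    linarith [hmd y hy]
  have hmem : ∀ y ∈ S.filter (fun y => dist z y < 2 * circumradius R), m y ∈ S₀ := by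
    intro y hy
    obtain ⟨hyS, hyd⟩ := Finset.mem_filter.1 hy
    refine (mem_nearCenters hR).2 ⟨fun h => ?_, hmP y hy, ?_⟩
    · have h1 := Q.two_mul_le_dist hR hz (hS y hyS).1 (hS y hyS).2.symm
      have h2 := dist_triangle_left z y x
      have h3 := hmd y hy
      rw [h] at h3
      linarith
    · have := (abs_le.1 (hdist y hy)).1
      linarith
  have hinj : Set.InjOn m (S.filter fun y => dist z y < 2 * circumradius R) := by
    intro y hy y' hy' hyy'
    by_contra hne
    have h1 := Q.two_mul_le_dist hR (hS y (Finset.mem_filter.1 hy).1).1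
      (hS y' (Finset.mem_filter.1 hy').1).1 hne
    have h2 := dist_triangle_left y y' (m y)
    have h3 := hmd y hy
    have h4 := hmd y' hy'
    rw [← hyy'] at h4
    linarith
  calc ∑ y ∈ S, lensArea R (dist z y)
      = ∑ y ∈ S.filter (fun y => dist z y < 2 * circumradius R), lensArea R (dist z y) := by
        rw [Finset.sum_filter]
        refine Finset.sum_congr rfl fun y _ => ?_
        split_ifs with hif
        · rfl
        · exact lensArea_eq_zero hR (not_lt.1 hif)
    _ ≤ ∑ y ∈ S.filter (fun y => dist z y < 2 * circumradius R),
          (lensArea R (dist x (m y)) + κ) :=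
        Finset.sum_le_sum fun y hy => hε1 _ (hmem y hy) _ (hdist y hy)
    _ = ∑ y' ∈ (S.filter (fun y => dist z y < 2 * circumradius R)).image m,
          (lensArea R (dist x y') + κ) := by
        rw [Finset.sum_image hinj]
    _ ≤ ∑ y' ∈ S₀, (lensArea R (dist x y') + κ) :=
        Finset.sum_le_sum_of_subset_of_nonneg (Finset.image_subset_iff.2 hmem)
          fun y _ _ => add_nonneg (lensArea_nonneg _ _) hκ0.le
    _ ≤ fullLensArea R - 2 * η + η := by
        rw [Finset.sum_add_distrib, Finset.sum_const, nsmul_eq_mul]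
        refine add_le_add h ?_
        rw [hκ, mul_div_assoc', div_le_iff₀ (by positivity)]
        nlinarith
    _ = fullLensArea R - η := by ring

theorem measure_interior_eq_zero {μ : Measure (DiskPacking R)} (hR : 0 < R)
    (hμ : IsInvariantProbability μ) (hopt : 1 ≤ ENNReal.ofReal inverseDensity * density μ)
    {E : Set (DiskPacking R)} {b r₁ : ℝ} (hb : 0 < b) (hr₁ : 0 ≤ r₁)
    (h : ∀ (Q : DiskPacking R) (r : ℝ), 0 < r →
      ENNReal.ofReal inverseDensity * volume.restrict (Metric.ball 0 r)
          {w | (0 : ℂ) ∈ (RigidMotion.translation (-w) • Q).covered}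
        + ENNReal.ofReal b * volume.restrict (Metric.ball 0 r)
          {w | RigidMotion.translation (-w) • Q ∈ E}
        ≤ ENNReal.ofReal (Real.pi * (r + r₁) ^ 2)) : μ (interior E) = 0 := by
  have h1 := density_add_measure_le_one hR hμ (isOpen_interior (s := E)).measurableSet
    (a := inverseDensity) (b := b) hr₁ fun Q r hr => by
      refine le_trans ?_ (h Q r hr)
      gcongr
      exact interior_subset
  by_contra h0
  have h2 : 0 < ENNReal.ofReal b * μ (interior E) :=
    ENNReal.mul_pos (by simpa using hb) h0
  have h3 : (1 : ℝ≥0∞) < 1 + ENNReal.ofReal b * μ (interior E) :=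
    ENNReal.lt_add_right ENNReal.one_ne_top h2.ne'
  exact absurd (h3.trans_le ((add_le_add hopt le_rfl).trans h1)) (lt_irrefl _)

theorem sum_lensArea_eq_of_mem_support {μ : Measure (DiskPacking R)} (hR : 0 < R)
    (hμ : IsInvariantProbability μ) (hopt : 1 ≤ ENNReal.ofReal inverseDensity * density μ)
    {P : DiskPacking R} (hP : P ∈ μ.support) {x : ℂ} (hx : x ∈ P.centers) :
    ∑ y ∈ P.nearCenters hR x, lensArea R (dist x y) = fullLensArea R := by
  have hρ := circumradius_pos hR
  have hpi := Real.pi_pos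
  refine le_antisymm (sum_lensArea_le hR x _ ?_ ?_) ?_
  · intro y hy
    rw [mem_nearCenters] at hy
    exact P.two_mul_le_dist hR hx hy.2.1 hy.1.symm
  · intro y hy y' hy' hne
    exact P.two_mul_le_dist hR ((mem_nearCenters hR).1 hy).2.1 ((mem_nearCenters hR).1 hy').2.1 hne
  · by_contra! hlt
    set η := (fullLensArea R - ∑ y ∈ P.nearCenters hR x, lensArea R (dist x y)) / 2 with hη
    have hη0 : 0 < η := by rw [hη]; linarith
    have hnhds := isDefect_mem_nhds hR hx hη0 (by rw [hη]; linarith)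
    have h1 := measure_interior_eq_zero hR hμ hopt (by positivity) (by positivity)
      fun Q r hr => covered_add_defect_le hR Q hη0 x hr
    exact ((Measure.mem_support_iff_forall P).1 hP _ (interior_mem_nhds.2 hnhds)).ne' h1

theorem nonempty_of_mem_support {μ : Measure (DiskPacking R)} (hR : 0 < R)
    (hμ : IsInvariantProbability μ) (hopt : 1 ≤ ENNReal.ofReal inverseDensity * density μ)
    {P : DiskPacking R} (hP : P ∈ μ.support) : P.centers.Nonempty := by
  have hρ := circumradius_pos hR
  by_contra h
  have hnhds := hasHole_mem_nhds hR (Set.not_nonempty_iff_eq_empty.1 h)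
  have h1 := measure_interior_eq_zero hR hμ hopt one_pos (by positivity)
    fun Q r hr => covered_add_hole_le hR Q hr
  exact ((Measure.mem_support_iff_forall P).1 hP _ (interior_mem_nhds.2 hnhds)).ne' h1

/-- The disk at `x` touches another one, and the disks that touch it are permuted by the rotations
about `x` by `π / 3`. -/
def IsSurrounded (P : DiskPacking R) (x : ℂ) : Prop :=
  (∃ v : ℂ, ‖v‖ = 1 ∧ x + 2 * R * v ∈ P.centers) ∧
    ∀ v : ℂ, ‖v‖ = 1 → x + 2 * R * v ∈ P.centers → x + 2 * R * (v * sixthRoot) ∈ P.centers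

theorem isSurrounded_of_sum_lensArea_eq (hR : 0 < R) {P : DiskPacking R} {x : ℂ}
    (hx : x ∈ P.centers)
    (h : ∑ y ∈ P.nearCenters hR x, lensArea R (dist x y) = fullLensArea R) :
    P.IsSurrounded x := by
  classical
  have hρ := circumradius_pos hR
  have hRC : (2 * R : ℂ) ≠ 0 := by
    have : (R : ℂ) ≠ 0 := by exact_mod_cast hR.ne'
    simpa using this
  have hR2 : ‖(2 * R : ℂ)‖ = 2 * R := by
    rw [norm_mul, Complex.norm_real, Real.norm_of_nonneg hR.le]; simp
  have hcard := (eq_of_sum_lensArea_eq hR x _ (fun y hy => P.two_mul_le_dist hR hx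
    ((mem_nearCenters hR).1 hy).2.1 ((mem_nearCenters hR).1 hy).1.symm)
    (fun y hy y' hy' hne => P.two_mul_le_dist hR ((mem_nearCenters hR).1 hy).2.1
      ((mem_nearCenters hR).1 hy').2.1 hne) h).2
  set F := (P.nearCenters hR x).filter fun y => dist x y = 2 * R with hF
  have hinj : Function.Injective fun y : ℂ => (y - x) / (2 * R) := by
    intro y y' hyy'
    simpa [div_left_inj' hRC] using hyy'
  set S := F.image fun y => (y - x) / (2 * R) with hS
  have hScard : S.card = 6 := by rw [hS, Finset.card_image_of_injective _ hinj, hcard]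
  have hSmem : ∀ v : ℂ, v ∈ S ↔ ‖v‖ = 1 ∧ x + 2 * R * v ∈ P.centers := by
    intro v
    constructor
    · intro hv
      obtain ⟨y, hy, rfl⟩ := Finset.mem_image.1 hv
      obtain ⟨hy1, hy2⟩ := Finset.mem_filter.1 hy
      refine ⟨?_, ?_⟩
      · rw [norm_div, hR2, ← dist_eq_norm, dist_comm, hy2, div_self (by positivity)]
      · rw [mul_div_cancel₀ _ hRC, add_sub_cancel]
        exact ((mem_nearCenters hR).1 hy1).2.1
    · rintro ⟨hv1, hv2⟩
      have hd : dist x (x + 2 * R * v) = 2 * R := by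
        rw [dist_self_add_right, norm_mul, hR2, hv1, mul_one]
      refine Finset.mem_image.2 ⟨x + 2 * R * v, Finset.mem_filter.2
        ⟨(mem_nearCenters hR).2 ⟨fun h => ?_, hv2, ?_⟩, hd⟩, ?_⟩
      · rw [h, dist_self] at hd; linarith
      · rw [hd, circumradius]
        have h3 : √3 ≤ 2 := by
          rw [Real.sqrt_le_left (by norm_num)]; norm_num
        have : R ≤ 2 * R / √3 := by
          rw [le_div_iff₀ (by positivity)]; nlinarith
        linarith
      · rw [add_sub_cancel_left, mul_div_cancel_left₀ _ hRC]
  have hsep : (S : Set ℂ).Pairwise fun v w => 1 ≤ dist v w := by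
    intro v hv w hw hne
    have h1 := P.two_mul_le_dist hR ((hSmem v).1 hv).2 ((hSmem w).1 hw).2
      (fun h => hne (mul_left_cancel₀ hRC (add_left_cancel h)))
    rw [dist_add_left, dist_eq_norm, ← mul_sub, norm_mul, hR2, ← dist_eq_norm] at h1
    nlinarith
  constructor
  · obtain ⟨v, hv⟩ := Finset.card_pos.1 (by rw [hScard]; norm_num : 0 < S.card)
    exact ⟨v, (hSmem v).1 hv⟩
  · intro v hv1 hv2
    exact ((hSmem _).1 (mul_sixthRoot_mem hScard (fun w hw => ((hSmem w).1 hw).1) hsep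
      ((hSmem v).2 ⟨hv1, hv2⟩))).2

theorem IsSurrounded.mul_pow {P : DiskPacking R} {x v : ℂ} (h : P.IsSurrounded x) (hv : ‖v‖ = 1)
    (hmem : x + 2 * R * v ∈ P.centers) (k : ℕ) :
    x + 2 * R * (v * sixthRoot ^ k) ∈ P.centers := by
  induction k with
  | zero => simpa using hmem
  | succ k ih =>
    rw [pow_succ, ← mul_assoc v]
    refine h.2 _ ?_ ih
    rw [norm_mul, norm_pow, norm_sixthRoot, one_pow, hv, one_mul]

theorem lattice_subset_centers {P : DiskPacking R} (h : ∀ x ∈ P.centers, P.IsSurrounded x)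
    {x v : ℂ} (hv : ‖v‖ = 1) (hx : x ∈ P.centers) (hmem : x + 2 * R * v ∈ P.centers) (a b : ℤ) :
    x + 2 * R * (v * (a + b * sixthRoot)) ∈ P.centers := by
  have hω3 := sixthRoot_pow_three
  have hω4 : sixthRoot ^ 4 = -sixthRoot := by linear_combination sixthRoot * sixthRoot_pow_three
  have hω5 : sixthRoot ^ 5 = -sixthRoot ^ 2 := by
    linear_combination sixthRoot ^ 2 * sixthRoot_pow_three
  have hnv : ‖-v‖ = 1 := by rw [norm_neg, hv]
  have hnω : ‖v * sixthRoot‖ = 1 := by rw [norm_mul, hv, norm_sixthRoot, one_mul]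
  have hnω' : ‖-(v * sixthRoot)‖ = 1 := by rw [norm_neg, hnω]
  -- a centre with a neighbour in direction `v` passes this property on to its neighbours
  have step : ∀ p, (p ∈ P.centers ∧ p + 2 * R * v ∈ P.centers) →
      (p + 2 * R * v ∈ P.centers ∧ p + 2 * R * v + 2 * R * v ∈ P.centers) ∧
      (p - 2 * R * v ∈ P.centers ∧ p - 2 * R * v + 2 * R * v ∈ P.centers) ∧
      (p + 2 * R * (v * sixthRoot) ∈ P.centers ∧
        p + 2 * R * (v * sixthRoot) + 2 * R * v ∈ P.centers) ∧
      (p - 2 * R * (v * sixthRoot) ∈ P.centers ∧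
        p - 2 * R * (v * sixthRoot) + 2 * R * v ∈ P.centers) := by
    rintro p ⟨hp, hpv⟩
    have hS := (h p hp).mul_pow hv hpv
    have m1 : p - 2 * R * v ∈ P.centers := by
      have := hS 3
      rw [hω3] at this
      convert this using 1; ring
    have m2 : p + 2 * R * (v * sixthRoot) ∈ P.centers := by simpa using hS 1
    have m3 : p - 2 * R * (v * sixthRoot) ∈ P.centers := by
      have := hS 4
      rw [hω4] at this
      convert this using 1; ring
    refine ⟨⟨hpv, ?_⟩, ⟨m1, by simpa using hp⟩, ⟨m2, ?_⟩, ⟨m3, ?_⟩⟩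
    · have := (h _ hpv).mul_pow hnv (by simpa using hp) 3
      rw [hω3] at this
      convert this using 1; ring
    · have := (h _ m2).mul_pow hnω' (by simpa using hp) 2
      convert this using 1
      linear_combination (2 * R * v) * hω3
    · have := (h _ m3).mul_pow hnω (by simpa using hp) 5
      convert this using 1
      rw [hω5]
      linear_combination (2 * R * v) * hω3
  have ha : ∀ a : ℤ, x + 2 * R * (v * a) ∈ P.centers ∧
      x + 2 * R * (v * a) + 2 * R * v ∈ P.centers := by
    intro a
    induction a using Int.induction_on with
    | zero => simpa using ⟨hx, hmem⟩
    | succ i ih =>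
      have := (step _ ih).1
      push_cast at *
      convert this using 2 <;> ring
    | pred i ih =>
      have := (step _ ih).2.1
      push_cast at *
      convert this using 2 <;> ring
  have hb : ∀ b : ℤ, x + 2 * R * (v * (a + b * sixthRoot)) ∈ P.centers ∧
      x + 2 * R * (v * (a + b * sixthRoot)) + 2 * R * v ∈ P.centers := by
    intro b
    induction b using Int.induction_on with
    | zero => simpa using ha a
    | succ i ih =>
      have := (step _ ih).2.2.1
      push_cast at *
      convert this using 2 <;> ring
    | pred i ih =>
      have := (step _ ih).2.2.2
      push_cast at *
      convert this using 2 <;> ring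
  exact (hb b).1

theorem mem_hexagonal {z : ℂ} :
    z ∈ (hexagonal R).centers ↔ ∃ a b : ℤ, z = 2 * R * (a + b * sixthRoot) := Iff.rfl

theorem mem_orbit_hexagonal_of_isSurrounded (hR : 0 < R) {P : DiskPacking R}
    (hne : P.centers.Nonempty) (h : ∀ x ∈ P.centers, P.IsSurrounded x) :
    P ∈ MulAction.orbit RigidMotion (hexagonal R) := by
  obtain ⟨x, hx⟩ := hne
  obtain ⟨v, hv, hmem⟩ := (h x hx).1
  obtain ⟨u, hu⟩ := exists_circle_mul v
  rw [hv, Complex.ofReal_one, one_mul] at hu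
  have hRC : (2 * R : ℂ) ≠ 0 := by
    have : (R : ℂ) ≠ 0 := by exact_mod_cast hR.ne'
    simpa using this
  have hv0 : v ≠ 0 := by rw [← norm_pos_iff, hv]; exact one_pos
  refine ⟨⟨u, x⟩, DiskPacking.ext (Set.Subset.antisymm ?_ ?_)⟩
  · rintro _ ⟨z, hz, rfl⟩
    obtain ⟨a, b, rfl⟩ := mem_hexagonal.1 hz
    have := lattice_subset_centers h hv hx hmem a b
    simp only [RigidMotion.smul_def]
    rw [← hu]
    convert this using 1
    ring
  · intro z hz
    obtain ⟨a, b, hab⟩ := exists_norm_sub_lattice_lt ((z - x) / (2 * R * v))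
    refine ⟨2 * R * (a + b * sixthRoot), mem_hexagonal.2 ⟨a, b, rfl⟩, ?_⟩
    simp only [RigidMotion.smul_def]
    rw [← hu]
    by_contra hne
    have h1 := P.two_mul_le_dist hR (lattice_subset_centers h hv hx hmem a b) hz (fun h => hne (by
      rw [← h]; ring))
    have h2 : z - (x + 2 * R * (v * (a + b * sixthRoot)))
        = (2 * R * v) * ((z - x) / (2 * R * v) - (a + b * sixthRoot)) := by
      rw [mul_sub, mul_div_cancel₀ _ (mul_ne_zero hRC hv0)]
      ring
    rw [dist_comm, dist_eq_norm, h2, norm_mul, norm_mul, norm_mul, hv, Complex.norm_real,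
      Real.norm_of_nonneg hR.le, Complex.norm_ofNat] at h1
    nlinarith

/-- The support of an invariant measure of greatest density consists of hexagonal packings. -/
theorem mem_orbit_hexagonal_of_mem_support {μ : Measure (DiskPacking R)} (hR : 0 < R)
    (hμ : IsInvariantProbability μ) (hopt : 1 ≤ ENNReal.ofReal inverseDensity * density μ)
    {P : DiskPacking R} (hP : P ∈ μ.support) :
    P ∈ MulAction.orbit RigidMotion (hexagonal R) :=
  mem_orbit_hexagonal_of_isSurrounded hR (nonempty_of_mem_support hR hμ hopt hP) fun _ hx =>
    isSurrounded_of_sum_lensArea_eq hR hx (sum_lensArea_eq_of_mem_support hR hμ hopt hP hx)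

end DiskPacking

noncomputable instance : MeasurableSpace Circle := borel Circle

instance : BorelSpace Circle := ⟨rfl⟩

/-- The normalized Haar measure of the circle. -/
noncomputable def circleHaar : Measure Circle :=
  Measure.haarMeasure (⊤ : TopologicalSpace.PositiveCompacts Circle)

instance : circleHaar.IsHaarMeasure := by unfold circleHaar; infer_instance

instance : IsProbabilityMeasure circleHaar := ⟨by
  have h := Measure.haarMeasure_self (K₀ := (⊤ : TopologicalSpace.PositiveCompacts Circle))
  simpa [circleHaar] using h⟩

namespace RigidMotion

instance : T2Space RigidMotion := homeoProd.isEmbedding.t2Space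

instance : SecondCountableTopology RigidMotion :=
  homeoProd.isEmbedding.secondCountableTopology

/-- The Haar measure of the group of rigid motions for which the motions that move the origin by
less than `r` have measure `π * r ^ 2`. -/
noncomputable def motionVolume : Measure RigidMotion :=
  (circleHaar.prod volume).map homeoProd.symm

theorem measurePreserving_homeoProd_symm :
    MeasurePreserving homeoProd.symm (circleHaar.prod volume) motionVolume :=
  ⟨homeoProd.symm.continuous.measurable, rfl⟩

theorem measurePreserving_of_semiconj {f : RigidMotion → RigidMotion} {F : Circle × ℂ → Circle × ℂ}
    (hf : Measurable f)
    (hF : MeasurePreserving F (circleHaar.prod volume) (circleHaar.prod volume))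
    (h : ∀ p, f (homeoProd.symm p) = homeoProd.symm (F p)) :
    MeasurePreserving f motionVolume motionVolume := by
  refine ⟨hf, ?_⟩
  have h1 : f ∘ homeoProd.symm = homeoProd.symm ∘ F := funext h
  rw [motionVolume, Measure.map_map hf homeoProd.symm.continuous.measurable, h1,
    ← Measure.map_map homeoProd.symm.continuous.measurable hF.measurable, hF.map_eq]

instance : motionVolume.IsMulLeftInvariant where
  map_mul_left_eq_self g := by
    refine (measurePreserving_of_semiconj (measurable_const_mul g)
      (F := Prod.map (g.rot * ·) fun w => (g.rot : ℂ) * w + g.trans) ?_ fun p => rfl).map_eq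
    refine (measurePreserving_mul_left circleHaar g.rot).prod ?_
    exact (measurePreserving_add_right volume g.trans).comp (rotation g.rot).measurePreserving

instance : motionVolume.IsMulRightInvariant where
  map_mul_right_eq_self g := by
    refine (measurePreserving_of_semiconj (measurable_mul_const g)
      (F := fun p => (p.1 * g.rot, (p.1 : ℂ) * g.trans + p.2)) ?_ fun p => rfl).map_eq
    refine (measurePreserving_mul_right circleHaar g.rot).skew_product
      (g := fun (u : Circle) (w : ℂ) => (u : ℂ) * g.trans + w) ?_ (ae_of_all _ fun u => ?_)
    · have : Continuous (Function.uncurry fun (u : Circle) (w : ℂ) => (u : ℂ) * g.trans + w) := by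
        unfold Function.uncurry
        fun_prop
      exact this.measurable
    · exact (measurePreserving_add_left volume ((u : ℂ) * g.trans)).map_eq

instance : IsFiniteMeasureOnCompacts motionVolume :=
  ⟨fun K hK => by
    rw [← measurePreserving_homeoProd_symm.measure_preimage hK.measurableSet.nullMeasurableSet]
    exact (homeoProd.symm.isCompact_preimage.2 hK).measure_lt_top⟩

instance : motionVolume.IsOpenPosMeasure :=
  homeoProd.symm.continuous.isOpenPosMeasure_map homeoProd.symm.surjective

instance : motionVolume.IsHaarMeasure where

theorem exists_haar_eq_smul :
    ∃ c : ℝ≥0, c ≠ 0 ∧ (Measure.haar : Measure RigidMotion) = c • motionVolume := by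
  refine ⟨_, ?_, Measure.isMulLeftInvariant_eq_smul Measure.haar motionVolume⟩
  intro h
  have h1 := Measure.isMulLeftInvariant_eq_smul Measure.haar motionVolume
  rw [h, zero_smul] at h1
  exact NeZero.ne (Measure.haar : Measure RigidMotion) h1

theorem setAverage_haar_eq (s : Set RigidMotion) (f : RigidMotion → ℝ) :
    ⨍ g in s, f g ∂Measure.haar = ⨍ g in s, f g ∂motionVolume := by
  obtain ⟨c, hc, h⟩ := exists_haar_eq_smul
  have hc' : (c : ℝ) ≠ 0 := by exact_mod_cast hc
  rw [h, setAverage_eq, setAverage_eq, Measure.restrict_smul, integral_smul_nnreal_measure,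
    measureReal_nnreal_smul_apply]
  simp only [NNReal.smul_def, smul_eq_mul]
  field_simp

theorem isOpen_near (r : ℝ) (p : ℂ) : IsOpen (near r p) := by
  have h1 := continuous_rot
  have h2 := continuous_trans
  have : Continuous fun g : RigidMotion => dist (g • p) p := by
    simp only [smul_def]; fun_prop
  exact isOpen_lt this continuous_const

theorem motionVolume_near {r : ℝ} (hr : 0 ≤ r) (p : ℂ) :
    motionVolume (near r p) = ENNReal.ofReal (Real.pi * r ^ 2) := by
  have hm := (isOpen_near r p).measurableSet
  rw [← measurePreserving_homeoProd_symm.measure_preimage hm.nullMeasurableSet,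
    Measure.prod_apply (homeoProd.symm.continuous.measurable hm)]
  have h : ∀ u : Circle, volume (Prod.mk u ⁻¹' (homeoProd.symm ⁻¹' near r p))
      = ENNReal.ofReal (Real.pi * r ^ 2) := by
    intro u
    rw [← volume_ball_eq_ofReal (p - u * p) hr]
    congr 1
    ext w
    change dist ((u : ℂ) * p + w) p < r ↔ dist w (p - u * p) < r
    rw [dist_eq_norm, dist_eq_norm]
    ring_nf
  simp [h]

theorem norm_smul_le (g : RigidMotion) (z : ℂ) : ‖g • z‖ ≤ ‖z‖ + ‖g.trans‖ := by
  rw [smul_def]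
  refine (norm_add_le _ _).trans ?_
  rw [norm_mul, Circle.norm_coe, one_mul]

theorem norm_inv_smul_le (g : RigidMotion) (z : ℂ) : ‖g⁻¹ • z‖ ≤ ‖z‖ + ‖g.trans‖ := by
  have h := norm_smul_le g⁻¹ z
  rwa [inv_trans, norm_neg, norm_mul, Circle.norm_coe, one_mul] at h

end RigidMotion

namespace DiskPacking

open RigidMotion

variable {R : ℝ}

/-- Changing the base point of an orbit changes integrals over large sets of motions only by a
boundary term. -/
theorem abs_setIntegral_sub_setIntegral_le {φ : RigidMotion → ℝ} (hφ : Measurable φ) {C : ℝ}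
    (hC : ∀ g, |φ g| ≤ C) (p : ℂ) (k : RigidMotion) {D r : ℝ} (hD : dist (k • p) p ≤ D)
    (hr : D ≤ r) :
    |∫ g in near r p, φ (g * k⁻¹) ∂motionVolume - ∫ g in near r p, φ g ∂motionVolume|
      ≤ C * (4 * Real.pi * D * r) := by
  have hD0 : 0 ≤ D := dist_nonneg.trans hD
  have hC0 : 0 ≤ C := (abs_nonneg _).trans (hC 1)
  have hm : ∀ r, MeasurableSet (near r p) := fun r => (isOpen_near r p).measurableSet
  set B := (fun g => g * k) ⁻¹' near r p with hB
  have hBm : MeasurableSet B := measurable_mul_const k (hm r)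
  have hnear : ∀ g : RigidMotion, |dist ((g * k) • p) p - dist (g • p) p| ≤ D := by
    intro g
    have h1 := abs_dist_sub_le ((g * k) • p) (g • p) p
    rw [mul_smul, RigidMotion.dist_smul] at h1
    rw [mul_smul]
    exact h1.trans hD
  have hBsub : B ⊆ near (r + D) p := by
    intro g hg
    have h1 := (abs_le.1 (hnear g)).1
    have h2 : dist ((g * k) • p) p < r := hg
    change dist (g • p) p < r + D
    linarith
  have hBsup : near (r - D) p ⊆ B := by
    intro g hg
    have h1 := (abs_le.1 (hnear g)).2
    have h2 : dist (g • p) p < r - D := hg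
    change dist ((g * k) • p) p < r
    linarith
  have hmono : ∀ {a b : ℝ}, a ≤ b → near a p ⊆ near b p := fun hab g hg => lt_of_lt_of_le hg hab
  have hvol : ∀ {a : ℝ}, 0 ≤ a → motionVolume.real (near a p) = Real.pi * a ^ 2 := by
    intro a ha
    rw [measureReal_def, motionVolume_near ha, ENNReal.toReal_ofReal (by positivity)]
  have hfin : ∀ {a : ℝ}, 0 ≤ a → motionVolume (near a p) ≠ ∞ := fun ha => by
    rw [motionVolume_near ha]; exact ENNReal.ofReal_ne_top
  have e1 : ∫ g in near r p, φ (g * k⁻¹) ∂motionVolume = ∫ g in B, φ g ∂motionVolume := by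
    rw [← integral_indicator (hm r), ← integral_indicator hBm,
      ← integral_mul_right_eq_self _ k]
    congr 1
    ext g
    by_cases hg : g * k ∈ near r p
    · rw [Set.indicator_of_mem hg, Set.indicator_of_mem (s := B) hg, mul_inv_cancel_right]
    · rw [Set.indicator_of_notMem hg, Set.indicator_of_notMem (s := B) hg]
  have hint : ∀ s : Set RigidMotion, MeasurableSet s → s ⊆ near (r + D) p →
      IntegrableOn φ s motionVolume := by
    intro s _ hs
    refine Measure.integrableOn_of_bounded (M := C) ?_ hφ.aestronglyMeasurable
      (ae_of_all _ hC)
    exact ((measure_mono hs).trans_lt (hfin (by linarith)).lt_top).ne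
  rw [e1, ← integral_indicator hBm, ← integral_indicator (hm r),
    ← integral_sub ((integrable_indicator_iff hBm).2 (hint B hBm hBsub))
      ((integrable_indicator_iff (hm r)).2 (hint _ (hm r) (hmono (by linarith))))]
  set A := near (r + D) p \ near (r - D) p with hA
  have hAm : MeasurableSet A := (hm _).diff (hm _)
  have hAfin : motionVolume A ≠ ∞ :=
    ((measure_mono Set.sdiff_subset).trans_lt (hfin (by linarith : 0 ≤ r + D)).lt_top).ne
  have hAvol : motionVolume.real A = 4 * Real.pi * D * r := by
    rw [hA, measureReal_sdiff (hmono (by linarith)) (hm _) (hfin (by linarith)),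
      hvol (by linarith), hvol (by linarith)]
    ring
  have hbound : ∀ g, ‖B.indicator φ g - (near r p).indicator φ g‖
      ≤ A.indicator (fun _ => C) g := by
    intro g
    by_cases h1 : g ∈ B <;> by_cases h2 : g ∈ near r p
    · simpa [h1, h2] using Set.indicator_nonneg (fun _ _ => hC0) g
    · have : g ∈ A := ⟨hBsub h1, fun h => h2 (hmono (by linarith) h)⟩
      simpa [h1, h2, this] using hC g
    · have : g ∈ A := ⟨hmono (by linarith) h2, fun h => h1 (hBsup h)⟩
      simpa [h1, h2, this] using hC g
    · simpa [h1, h2] using Set.indicator_nonneg (fun _ _ => hC0) g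
  refine (norm_integral_le_of_norm_le ((integrable_indicator_iff hAm).2
    (integrableOn_const hAfin)) (ae_of_all _ hbound)).trans ?_
  rw [integral_indicator hAm, setIntegral_const, hAvol, smul_eq_mul, mul_comm]

/-- If the image of a compactly supported probability measure on the group under the orbit map of
`H` is invariant, then orbit averages of every packing in the orbit of `H` converge. -/
theorem tendsto_setAverage_of_invariant {H : DiskPacking R} {κ : Measure RigidMotion}
    [IsProbabilityMeasure κ]
    (hinv : SMulInvariantMeasure RigidMotion (DiskPacking R) (κ.map (· • H))) {D₀ : ℝ}
    (hκ : ∀ᵐ k ∂κ, ‖k.trans‖ ≤ D₀) (h : RigidMotion) (p : ℂ) {f : DiskPacking R → ℝ}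
    (hf : Measurable f) {C : ℝ} (hC : ∀ g : RigidMotion, |f (g • H)| ≤ C) :
    Tendsto (fun r : ℝ => ⨍ g in near r p, f (g • h • H) ∂motionVolume) atTop
      (𝓝 (∫ Q, f Q ∂κ.map (· • H))) := by
  have hC0 : 0 ≤ C := (abs_nonneg _).trans (hC 1)
  have horb : Measurable fun g : RigidMotion => g • H :=
    (continuous_id.smul continuous_const).measurable
  set m := ∫ Q, f Q ∂κ.map (· • H) with hmdef
  set D := max 0 (2 * ‖p‖ + D₀ + ‖h.trans‖) with hDdef
  have hφ : Measurable fun g : RigidMotion => f (g • h • H) :=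
    hf.comp (continuous_id.smul continuous_const).measurable
  have hφC : ∀ g : RigidMotion, |f (g • h • H)| ≤ C := fun g => by
    rw [← mul_smul]; exact hC _
  have hbound : ∀ r : ℝ, D < r →
      |(⨍ g in near r p, f (g • h • H) ∂motionVolume) - m| ≤ 4 * C * D / r := by
    intro r hr
    have hr0 : 0 < r := (le_max_left _ _).trans_lt hr
    have hVr : motionVolume.real (near r p) = Real.pi * r ^ 2 := by
      rw [measureReal_def, motionVolume_near hr0.le, ENNReal.toReal_ofReal (by positivity)]
    have : IsFiniteMeasure (motionVolume.restrict (near r p)) :=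
      isFiniteMeasure_restrict.2 (by rw [motionVolume_near hr0.le]; exact ENNReal.ofReal_ne_top)
    set I := ∫ g in near r p, f (g • h • H) ∂motionVolume with hI
    have hprod : Integrable (Function.uncurry fun (k g : RigidMotion) => f (g • k • H))
        (κ.prod (motionVolume.restrict (near r p))) := by
      refine Integrable.of_bound (C := C) ?_ (ae_of_all _ fun q => ?_)
      · have hc : Continuous fun q : RigidMotion × RigidMotion => q.2 • q.1 • H :=
          continuous_snd.smul (continuous_fst.smul continuous_const)
        exact (hf.comp hc.measurable).aestronglyMeasurable
      · simp only [Function.uncurry, ← mul_smul]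
        exact hC _
    have hJm : ∫ k, ∫ g in near r p, f (g • k • H) ∂motionVolume ∂κ = Real.pi * r ^ 2 * m := by
      rw [integral_integral_swap hprod]
      have h1 : ∀ g : RigidMotion, ∫ k, f (g • k • H) ∂κ = m := by
        intro g
        rw [hmdef, ← integral_smul_eq_self (μ := κ.map (· • H)) f (g := g)]
        exact (integral_map horb.aemeasurable
          (hf.comp (measurable_const_smul g)).aestronglyMeasurable).symm
      simp only [h1, setIntegral_const, hVr, smul_eq_mul]
    have hJ : ∀ᵐ k ∂κ, ‖∫ g in near r p, f (g • k • H) ∂motionVolume - I‖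
        ≤ C * (4 * Real.pi * D * r) := by
      filter_upwards [hκ] with k hk
      have h1 := abs_setIntegral_sub_setIntegral_le hφ hφC p (h * k⁻¹) (D := D) (r := r) ?_ hr.le
      · simpa [mul_smul] using h1
      · refine le_trans ?_ (le_max_right _ _)
        rw [dist_eq_norm]
        refine (norm_sub_le _ _).trans ?_
        rw [mul_smul]
        have h2 := norm_smul_le h (k⁻¹ • p)
        have h3 := norm_inv_smul_le k p
        linarith
    have hJint : Integrable (fun k => ∫ g in near r p, f (g • k • H) ∂motionVolume) κ :=
      hprod.integral_prod_left
    have h2 : |Real.pi * r ^ 2 * m - I| ≤ C * (4 * Real.pi * D * r) := by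
      have h3 := norm_integral_le_of_norm_le_const hJ
      rw [integral_sub hJint (integrable_const I), hJm] at h3
      simpa using h3
    rw [setAverage_eq, hVr, ← hI, smul_eq_mul]
    have h4 : (Real.pi * r ^ 2)⁻¹ * I - m = -((Real.pi * r ^ 2)⁻¹ * (Real.pi * r ^ 2 * m - I)) := by
      have := Real.pi_pos
      field_simp
      ring
    rw [h4, abs_neg, abs_mul, abs_of_pos (by have := Real.pi_pos; positivity)]
    calc _ ≤ (Real.pi * r ^ 2)⁻¹ * (C * (4 * Real.pi * D * r)) := by
          have := Real.pi_pos
          gcongr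
      _ = 4 * C * D / r := by
          have := Real.pi_pos
          field_simp
  rw [tendsto_iff_norm_sub_tendsto_zero]
  refine squeeze_zero' (Eventually.of_forall fun _ => norm_nonneg _)
    ((eventually_gt_atTop D).mono hbound) ?_
  exact tendsto_const_nhds.div_atTop tendsto_id

/-- Such an image measure is the only invariant probability measure that is absolutely continuous
with respect to it. -/
theorem eq_of_absolutelyContinuous {H : DiskPacking R} {κ : Measure RigidMotion}
    [IsProbabilityMeasure κ]
    (hinv : SMulInvariantMeasure RigidMotion (DiskPacking R) (κ.map (· • H))) {D₀ : ℝ}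
    (hκ : ∀ᵐ k ∂κ, ‖k.trans‖ ≤ D₀) {μ : Measure (DiskPacking R)} (hμ : IsInvariantProbability μ)
    (hac : μ ≪ κ.map (· • H)) : μ = κ.map (· • H) := by
  have := hμ.1
  have := hμ.2
  have horb : Measurable fun g : RigidMotion => g • H :=
    (continuous_id.smul continuous_const).measurable
  have : IsProbabilityMeasure (κ.map (· • H)) := Measure.isProbabilityMeasure_map horb.aemeasurable
  ext A hA
  set f : DiskPacking R → ℝ := A.indicator 1 with hfdef
  have hf : Measurable f := measurable_one.indicator hA
  have hf1 : ∀ Q, ‖f Q‖ ≤ 1 := fun Q => by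
    rw [hfdef]; refine (norm_indicator_le_norm_self _ _).trans (by simp)
  have hc : Continuous fun q : DiskPacking R × RigidMotion => q.2 • q.1 :=
    continuous_snd.smul continuous_fst
  have hjoint : Measurable fun q : DiskPacking R × RigidMotion => f (q.2 • q.1) :=
    hf.comp hc.measurable
  have hV : ∀ n : ℕ, motionVolume.real (near (n + 1) 0) = Real.pi * ((n : ℝ) + 1) ^ 2 := by
    intro n
    rw [measureReal_def, motionVolume_near (by positivity), ENNReal.toReal_ofReal (by positivity)]
  have hfinm : ∀ n : ℕ, IsFiniteMeasure (motionVolume.restrict (near ((n : ℝ) + 1) 0)) := fun n =>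
    isFiniteMeasure_restrict.2
      (by rw [motionVolume_near (by positivity)]; exact ENNReal.ofReal_ne_top)
  set Φ : ℕ → DiskPacking R → ℝ := fun n P =>
    ⨍ g in near ((n : ℝ) + 1) 0, f (g • P) ∂motionVolume with hΦ
  have hΦm : ∀ n, Measurable (Φ n) := by
    intro n
    have h1 : StronglyMeasurable fun P => ∫ g in near ((n : ℝ) + 1) 0, f (g • P) ∂motionVolume :=
      hjoint.stronglyMeasurable.integral_prod_right'
    simp only [hΦ, setAverage_eq]
    exact h1.measurable.const_smul (motionVolume.real (near ((n : ℝ) + 1) 0))⁻¹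
  have hΦ1 : ∀ n P, ‖Φ n P‖ ≤ 1 := by
    intro n P
    have h1 := norm_setIntegral_le_of_norm_le_const (μ := motionVolume) (s := near ((n : ℝ) + 1) 0)
      (f := fun g => f (g • P)) (C := 1)
      (by rw [motionVolume_near (by positivity)]; exact ENNReal.ofReal_lt_top) fun g _ => hf1 _
    simp only [hΦ, setAverage_eq]
    rw [norm_smul, hV]
    rw [hV] at h1
    have hpos : 0 < Real.pi * ((n : ℝ) + 1) ^ 2 := by have := Real.pi_pos; positivity
    rw [norm_inv, Real.norm_of_nonneg hpos.le, inv_mul_le_iff₀ hpos, mul_one]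
    linarith
  have hΦint : ∀ n, ∫ P, Φ n P ∂μ = μ.real A := by
    intro n
    have := hfinm n
    have hprod : Integrable
        (Function.uncurry fun (P : DiskPacking R) (g : RigidMotion) => f (g • P))
        (μ.prod (motionVolume.restrict (near ((n : ℝ) + 1) 0))) :=
      Integrable.of_bound hjoint.aestronglyMeasurable 1 (ae_of_all _ fun q => hf1 _)
    simp only [hΦ, setAverage_eq]
    rw [integral_smul, integral_integral_swap hprod]
    have h1 : ∀ g : RigidMotion, ∫ P, f (g • P) ∂μ = μ.real A := fun g => by
      rw [integral_smul_eq_self f (g := g), hfdef, integral_indicator_one hA]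
    have hpos : 0 < Real.pi * ((n : ℝ) + 1) ^ 2 := by have := Real.pi_pos; positivity
    simp only [h1, setIntegral_const, hV, smul_eq_mul]
    field_simp
  have hlim : ∀ᵐ P ∂μ, Tendsto (fun n => Φ n P) atTop (𝓝 ((κ.map (· • H)).real A)) := by
    refine hac.ae_le ?_
    refine (ae_map_iff horb.aemeasurable (measurableSet_tendsto _ hΦm)).2 (ae_of_all _ fun k => ?_)
    have h1 := tendsto_setAverage_of_invariant hinv hκ k 0 hf (C := 1) fun g => hf1 _
    rw [hfdef, integral_indicator_one hA] at h1
    have h2 : Tendsto (fun n : ℕ => (n : ℝ) + 1) atTop atTop :=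
      tendsto_atTop_add_const_right _ _ tendsto_natCast_atTop_atTop
    exact h1.comp h2
  have hconv := tendsto_integral_of_dominated_convergence (μ := μ) (fun _ => (1 : ℝ))
    (fun n => (hΦm n).aestronglyMeasurable) (integrable_const _)
    (fun n => ae_of_all _ (hΦ1 n)) hlim
  simp only [hΦint, integral_const, probReal_univ, one_smul] at hconv
  have h5 : μ.real A = (κ.map (· • H)).real A := tendsto_nhds_unique tendsto_const_nhds hconv
  exact (measureReal_eq_measureReal_iff).1 h5

theorem orbit_subset_support_of_invariant {H : DiskPacking R} {κ : Measure RigidMotion}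
    [IsProbabilityMeasure κ]
    (hinv : SMulInvariantMeasure RigidMotion (DiskPacking R) (κ.map (· • H))) (h : RigidMotion) :
    h • H ∈ (κ.map (· • H)).support := by
  have horb : Continuous fun g : RigidMotion => g • H := continuous_id.smul continuous_const
  refine (Measure.mem_support_iff_forall _).2 fun U hU => ?_
  by_contra h0
  obtain ⟨W, hWU, hW, hhW⟩ := mem_nhds_iff.1 hU
  have hW0 : κ.map (· • H) W = 0 :=
    le_antisymm ((measure_mono hWU).trans (not_lt.1 h0)) zero_le
  have hc : Continuous fun q : RigidMotion × RigidMotion => q.2 • q.1 • H :=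
    continuous_snd.smul (continuous_fst.smul continuous_const)
  have hm : MeasurableSet {q : RigidMotion × RigidMotion | q.2 • q.1 • H ∈ W} :=
    hc.measurable hW.measurableSet
  have h1 : (κ.prod motionVolume) {q | q.2 • q.1 • H ∈ W} = 0 := by
    rw [Measure.prod_apply_symm hm]
    refine (lintegral_eq_zero_iff (measurable_measure_prodMk_right hm)).2 (ae_of_all _ fun g => ?_)
    have h2 := measure_preimage_smul_of_nullMeasurableSet (μ := κ.map (· • H))
      hW.measurableSet.nullMeasurableSet g
    rw [hW0, Measure.map_apply horb.measurable
      ((continuous_const_smul g).measurable hW.measurableSet)] at h2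
    exact h2
  rw [Measure.prod_apply hm] at h1
  have h3 := (lintegral_eq_zero_iff (measurable_measure_prodMk_left hm)).1 h1
  obtain ⟨k, hk⟩ := h3.exists
  have h4 : motionVolume ((fun g => g * k) ⁻¹' ((· • H) ⁻¹' W)) = 0 := by
    refine Eq.trans ?_ hk
    congr 1
    ext g
    simp [mul_smul]
  rw [measure_preimage_mul_right] at h4
  exact ((hW.preimage horb).measure_pos motionVolume ⟨h, hhW⟩).ne' h4

theorem linearIndependent_hexagonal (hR : 0 < R) :
    LinearIndependent ℝ ![(2 * R : ℂ), 2 * R * sixthRoot] := by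
  rw [LinearIndependent.pair_iff]
  intro s t h
  have him := congrArg Complex.im h
  have hre := congrArg Complex.re h
  simp [sixthRoot_re, sixthRoot_im, hR.ne'] at him hre
  subst him
  simpa [hR.ne'] using hre

/-- The basis of the lattice of centres of the hexagonal packing. -/
noncomputable def hexagonalBasis (hR : 0 < R) : Module.Basis (Fin 2) ℝ ℂ :=
  basisOfLinearIndependentOfCardEqFinrank (linearIndependent_hexagonal hR)
    (by simp [Complex.finrank_real_complex])

theorem coe_hexagonalBasis (hR : 0 < R) :
    ⇑(hexagonalBasis hR) = ![(2 * R : ℂ), 2 * R * sixthRoot] :=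
  coe_basisOfLinearIndependentOfCardEqFinrank _ _

theorem mem_span_hexagonalBasis (hR : 0 < R) {z : ℂ} :
    z ∈ Submodule.span ℤ (Set.range (hexagonalBasis hR)) ↔ z ∈ (hexagonal R).centers := by
  rw [coe_hexagonalBasis, Matrix.range_cons, Matrix.range_cons, Matrix.range_empty,
    Set.union_empty, Set.singleton_union, Submodule.mem_span_pair, mem_hexagonal]
  simp only [zsmul_eq_mul]
  constructor
  · rintro ⟨a, b, rfl⟩
    exact ⟨a, b, by ring⟩
  · rintro ⟨a, b, rfl⟩
    exact ⟨a, b, by ring⟩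

theorem countable_span_hexagonalBasis (hR : 0 < R) :
    Countable (Submodule.span ℤ (Set.range (hexagonalBasis hR))).toAddSubgroup := by
  have h : (hexagonal R).centers
      = Set.range fun p : ℤ × ℤ => (2 * R * (p.1 + p.2 * sixthRoot) : ℂ) := by
    ext z
    simp [mem_hexagonal, eq_comm]
  have hc : (hexagonal R).centers.Countable := h ▸ Set.countable_range _
  exact (hc.mono fun z hz => (mem_span_hexagonalBasis hR).1 hz :
    {z | z ∈ Submodule.span ℤ (Set.range (hexagonalBasis hR))}.Countable).to_subtype

/-- A period parallelogram of the hexagonal packing. -/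
noncomputable def hexagonalCell (hR : 0 < R) : Set ℂ :=
  ZSpan.fundamentalDomain (hexagonalBasis hR)

theorem isAddFundamentalDomain_hexagonalCell (hR : 0 < R) :
    IsAddFundamentalDomain (Submodule.span ℤ (Set.range (hexagonalBasis hR))).toAddSubgroup
      (hexagonalCell hR) volume :=
  ZSpan.isAddFundamentalDomain' _ _

theorem volume_hexagonalCell (hR : 0 < R) :
    volume (hexagonalCell hR) = ENNReal.ofReal (2 * √3 * R ^ 2) := by
  rw [hexagonalCell, ZSpan.measure_fundamentalDomain _ _ Complex.orthonormalBasisOneI.toBasis,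
    measure_congr (ZSpan.fundamentalDomain_ae_parallelepiped _ _),
    OrthonormalBasis.coe_toBasis, OrthonormalBasis.volume_parallelepiped, mul_one]
  congr 1
  rw [Module.Basis.det_apply, Matrix.det_fin_two]
  simp [Module.Basis.toMatrix_apply, coe_hexagonalBasis, sixthRoot_re, sixthRoot_im]
  rw [abs_of_pos hR, abs_of_pos (by positivity : 0 < √3 / 2)]
  ring

/-- The motion that first translates by `t` and then rotates by `u`. -/
noncomputable def rotTrans (p : Circle × ℂ) : RigidMotion := ⟨p.1, p.1 * p.2⟩

theorem continuous_rotTrans : Continuous rotTrans := by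
  refine homeoProd.symm.continuous.comp (f := fun p : Circle × ℂ => (p.1, (p.1 : ℂ) * p.2)) ?_
  fun_prop

theorem rotTrans_smul_hexagonal_add (hR : 0 < R) (u : Circle) (t : ℂ) {l : ℂ}
    (hl : l ∈ (hexagonal R).centers) :
    rotTrans (u, t + l) • hexagonal R = rotTrans (u, t) • hexagonal R := by
  have hsub : ∀ (t l : ℂ), l ∈ (hexagonal R).centers →
      (rotTrans (u, t + l) • hexagonal R).centers
        ⊆ (rotTrans (u, t) • hexagonal R).centers := by
    rintro t l hl _ ⟨z, hz, rfl⟩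
    rw [← mem_span_hexagonalBasis hR] at hl hz
    refine ⟨z + l, (mem_span_hexagonalBasis hR).1 (add_mem hz hl), ?_⟩
    simp only [RigidMotion.smul_def, rotTrans]
    ring
  refine DiskPacking.ext (Set.Subset.antisymm (hsub t l hl) ?_)
  have h := hsub (t + l) (-l) ((mem_span_hexagonalBasis hR).1
    (neg_mem ((mem_span_hexagonalBasis hR).2 hl)))
  rwa [add_neg_cancel_right] at h

/-- The uniform distribution on the period parallelogram. -/
noncomputable def cellMeasure (hR : 0 < R) : Measure ℂ :=
  ProbabilityTheory.cond volume (hexagonalCell hR)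

theorem measurableSet_hexagonalCell (hR : 0 < R) : MeasurableSet (hexagonalCell hR) :=
  ZSpan.fundamentalDomain_measurableSet _

theorem isProbabilityMeasure_cellMeasure (hR : 0 < R) : IsProbabilityMeasure (cellMeasure hR) := by
  have h := volume_hexagonalCell hR
  refine ProbabilityTheory.cond_isProbabilityMeasure_of_finite ?_ ?_
  · rw [h]
    simp only [ne_eq, ENNReal.ofReal_eq_zero, not_le]
    positivity
  · rw [h]; exact ENNReal.ofReal_ne_top

/-- The distribution of a random motion whose image of the hexagonal packing is uniform. -/
noncomputable def cellMotionMeasure (hR : 0 < R) : Measure RigidMotion :=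
  (circleHaar.prod (cellMeasure hR)).map rotTrans

theorem isProbabilityMeasure_cellMotionMeasure (hR : 0 < R) :
    IsProbabilityMeasure (cellMotionMeasure hR) :=
  have := isProbabilityMeasure_cellMeasure hR
  Measure.isProbabilityMeasure_map continuous_rotTrans.measurable.aemeasurable

/-- The uniform measure on the orbit of the hexagonal packing. -/
noncomputable def hexagonalMeasure (hR : 0 < R) : Measure (DiskPacking R) :=
  (cellMotionMeasure hR).map (· • hexagonal R)

theorem measurable_orbitMap (H : DiskPacking R) : Measurable fun g : RigidMotion => g • H :=
  (continuous_id.smul continuous_const).measurable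

theorem hexagonalMeasure_apply (hR : 0 < R) {A : Set (DiskPacking R)} (hA : MeasurableSet A) :
    hexagonalMeasure hR A
      = ∫⁻ u, cellMeasure hR {t | rotTrans (u, t) • hexagonal R ∈ A} ∂circleHaar := by
  have := isProbabilityMeasure_cellMeasure hR
  rw [hexagonalMeasure, Measure.map_apply (measurable_orbitMap _) hA, cellMotionMeasure,
    Measure.map_apply continuous_rotTrans.measurable (measurable_orbitMap _ hA),
    Measure.prod_apply (continuous_rotTrans.measurable (measurable_orbitMap _ hA))]
  rfl

/-- The uniform distribution on a period parallelogram gives translates of a periodic set the same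
measure. -/
theorem cellMeasure_preimage_add (hR : 0 < R) {S : Set ℂ} (hS : MeasurableSet S)
    (hper : ∀ l ∈ (hexagonal R).centers, ∀ t, t + l ∈ S ↔ t ∈ S) (c : ℂ) :
    cellMeasure hR {t | t + c ∈ S} = cellMeasure hR S := by
  have := countable_span_hexagonalBasis hR
  have hF := isAddFundamentalDomain_hexagonalCell hR
  have hFm := measurableSet_hexagonalCell hR
  have hFc : IsAddFundamentalDomain
      (Submodule.span ℤ (Set.range (hexagonalBasis hR))).toAddSubgroup
      (c +ᵥ hexagonalCell hR) volume := hF.vadd_of_comm c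
  rw [cellMeasure, ProbabilityTheory.cond_apply hFm, ProbabilityTheory.cond_apply hFm]
  congr 1
  have h1 := hF.measure_set_eq hFc hS (fun l => by
    ext t
    simp only [Set.mem_preimage]
    change (l : ℂ) + t ∈ S ↔ t ∈ S
    rw [add_comm]
    exact hper l ((mem_span_hexagonalBasis hR).1 l.2) t)
  rw [Set.inter_comm _ S, h1, ← measure_preimage_add_right volume c (S ∩ (c +ᵥ hexagonalCell hR))]
  congr 1
  ext t
  simp [Set.mem_vadd_set_iff_neg_vadd_mem, and_comm]

theorem smulInvariantMeasure_hexagonalMeasure (hR : 0 < R) :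
    SMulInvariantMeasure RigidMotion (DiskPacking R) (hexagonalMeasure hR) := by
  refine ⟨fun g A hA => ?_⟩
  rw [hexagonalMeasure_apply hR hA,
    hexagonalMeasure_apply hR ((continuous_const_smul g).measurable hA),
    ← lintegral_mul_left_eq_self
      (fun u => cellMeasure hR {t | rotTrans (u, t) • hexagonal R ∈ A}) g.rot]
  refine lintegral_congr fun u => ?_
  have hcomp : ∀ t, g • rotTrans (u, t) • hexagonal R
      = rotTrans (g.rot * u, t + ((g.rot * u)⁻¹ : Circle) * g.trans) • hexagonal R := by
    intro t
    rw [← mul_smul]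
    congr 1
    ext
    · rfl
    · simp only [rotTrans, RigidMotion.mul_trans]
      rw [mul_add, ← mul_assoc _ _ g.trans, ← Circle.coe_mul, mul_inv_cancel, Circle.coe_one,
        one_mul, Circle.coe_mul, mul_assoc]
  rw [← cellMeasure_preimage_add hR (S := {t | rotTrans (g.rot * u, t) • hexagonal R ∈ A}) ?_ ?_
    (((g.rot * u)⁻¹ : Circle) * g.trans)]
  · congr 1
    ext t
    change g • rotTrans (u, t) • hexagonal R ∈ A ↔ _
    rw [hcomp]
    rfl
  · have hc : Continuous fun t : ℂ => rotTrans (g.rot * u, t) :=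
      continuous_rotTrans.comp (continuous_const.prodMk continuous_id)
    exact ((measurable_orbitMap _).comp hc.measurable) hA
  · intro l hl t
    change rotTrans (g.rot * u, t + l) • hexagonal R ∈ A ↔ rotTrans (g.rot * u, t) • hexagonal R ∈ A
    rw [rotTrans_smul_hexagonal_add hR _ _ hl]

theorem isInvariantProbability_hexagonalMeasure (hR : 0 < R) :
    IsInvariantProbability (hexagonalMeasure hR) :=
  have := isProbabilityMeasure_cellMotionMeasure hR
  ⟨Measure.isProbabilityMeasure_map (measurable_orbitMap _).aemeasurable,
    smulInvariantMeasure_hexagonalMeasure hR⟩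

theorem exists_norm_trans_le (hR : 0 < R) :
    ∃ D₀ : ℝ, ∀ᵐ k ∂cellMotionMeasure hR, ‖k.trans‖ ≤ D₀ := by
  obtain ⟨D₀, hD₀⟩ := (ZSpan.fundamentalDomain_isBounded (hexagonalBasis hR)).exists_norm_le
  refine ⟨D₀, ?_⟩
  have := isProbabilityMeasure_cellMeasure hR
  have hm : MeasurableSet {k : RigidMotion | ‖k.trans‖ ≤ D₀} :=
    (isClosed_le RigidMotion.continuous_trans.norm continuous_const).measurableSet
  refine (ae_map_iff continuous_rotTrans.measurable.aemeasurable hm).2 ?_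
  have h1 : ∀ᵐ t ∂cellMeasure hR, t ∈ hexagonalCell hR :=
    ProbabilityTheory.ae_cond_mem (measurableSet_hexagonalCell hR)
  have h2 : ∀ᵐ p ∂circleHaar.prod (cellMeasure hR), p.2 ∈ hexagonalCell hR :=
    Measure.quasiMeasurePreserving_snd.ae h1
  filter_upwards [h2] with p hp
  change ‖(p.1 : ℂ) * p.2‖ ≤ D₀
  rw [norm_mul, Circle.norm_coe, one_mul]
  exact hD₀ _ hp

theorem volume_hexagonalCell_inter_covered (hR : 0 < R) :
    ENNReal.ofReal (Real.pi * R ^ 2)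
      ≤ volume (hexagonalCell hR ∩ {t | ∃ x ∈ (hexagonal R).centers, ‖x + t‖ ≤ R}) := by
  have := countable_span_hexagonalBasis hR
  have hF := isAddFundamentalDomain_hexagonalCell hR
  have hFm := measurableSet_hexagonalCell hR
  rw [← volume_ball_eq_ofReal 0 hR.le, hF.measure_eq_tsum]
  have hball : ∀ l : (Submodule.span ℤ (Set.range (hexagonalBasis hR))).toAddSubgroup,
      l +ᵥ Metric.ball (0 : ℂ) R = Metric.ball (l : ℂ) R := by
    intro l
    have : l +ᵥ Metric.ball (0 : ℂ) R = (l : ℂ) +ᵥ Metric.ball (0 : ℂ) R := rfl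
    rw [this, Metric.vadd_ball, vadd_eq_add, add_zero]
  simp only [hball]
  rw [← measure_iUnion]
  · refine measure_mono ?_
    rintro t ht
    obtain ⟨l, hl, htF⟩ := Set.mem_iUnion.1 ht
    refine ⟨htF, -l, (mem_span_hexagonalBasis hR).1 (neg_mem l.2), ?_⟩
    rw [mem_ball_iff_norm] at hl
    rw [neg_add_eq_sub]
    exact hl.le
  · intro l l' hll'
    have h1 := (hexagonal R).disjoint_interiors ((mem_span_hexagonalBasis hR).1 l.2)
      ((mem_span_hexagonalBasis hR).1 l'.2) (fun h => hll' (Subtype.ext h))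
    exact h1.mono Set.inter_subset_left Set.inter_subset_left
  · exact fun l => measurableSet_ball.inter hFm

theorem one_le_density_hexagonalMeasure (hR : 0 < R) :
    1 ≤ ENNReal.ofReal inverseDensity * density (hexagonalMeasure hR) := by
  have hpi := Real.pi_pos
  rw [density, hexagonalMeasure_apply hR (isClosed_zero_mem_covered hR).measurableSet]
  have h1 : ∀ u : Circle, {t : ℂ | rotTrans (u, t) • hexagonal R ∈
      {P : DiskPacking R | (0 : ℂ) ∈ P.covered}}
      = {t | ∃ x ∈ (hexagonal R).centers, ‖x + t‖ ≤ R} := by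
    intro u
    ext t
    change (0 : ℂ) ∈ (rotTrans (u, t) • hexagonal R).covered ↔ _
    rw [mem_covered]
    have h2 : ∀ x : ℂ, dist 0 (rotTrans (u, t) • x) = ‖x + t‖ := by
      intro x
      rw [dist_zero_left, RigidMotion.smul_def]
      change ‖(u : ℂ) * x + u * t‖ = _
      rw [← mul_add, norm_mul, Circle.norm_coe, one_mul]
    constructor
    · rintro ⟨_, ⟨x, hx, rfl⟩, hd⟩
      exact ⟨x, hx, by rw [← h2]; exact hd⟩
    · rintro ⟨x, hx, hd⟩
      exact ⟨_, smul_mem_smul_centers _ hx, by rw [h2]; exact hd⟩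
  simp only [h1, lintegral_const, measure_univ, mul_one]
  rw [cellMeasure, ProbabilityTheory.cond_apply (measurableSet_hexagonalCell hR),
    volume_hexagonalCell hR]
  refine le_trans ?_ (mul_le_mul_right (mul_le_mul_right
    (volume_hexagonalCell_inter_covered hR) _) _)
  rw [← ENNReal.ofReal_inv_of_pos (by positivity), ← ENNReal.ofReal_mul (by positivity),
    ← ENNReal.ofReal_mul (by unfold inverseDensity; positivity), ENNReal.one_le_ofReal]
  unfold inverseDensity
  refine le_of_eq ?_
  field_simp

theorem inverseDensity_mul_density_le (hR : 0 < R) {μ : Measure (DiskPacking R)}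
    (hμ : IsInvariantProbability μ) : ENNReal.ofReal inverseDensity * density μ ≤ 1 := by
  have hρ := circumradius_pos hR
  have h := density_add_measure_le_one hR hμ MeasurableSet.empty (a := inverseDensity) (b := 1)
    (r₁ := R + circumradius R) (by positivity) fun Q r hr => by
      refine le_trans ?_ (covered_add_hole_le hR Q hr)
      gcongr
      exact Set.empty_subset _
  simpa using h

theorem inverseDensity_mul_optimalDensity (hR : 0 < R) :
    ENNReal.ofReal inverseDensity * optimalDensity R = 1 := by
  refine le_antisymm ?_ ?_
  · rw [optimalDensity, ENNReal.mul_iSup]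
    refine iSup_le fun μ => ?_
    rw [ENNReal.mul_iSup]
    exact iSup_le fun hμ => inverseDensity_mul_density_le hR hμ
  · refine (one_le_density_hexagonalMeasure hR).trans ?_
    gcongr
    exact le_iSup₂_of_le _ (isInvariantProbability_hexagonalMeasure hR) le_rfl

theorem density_hexagonalMeasure (hR : 0 < R) :
    density (hexagonalMeasure hR) = optimalDensity R := by
  have h1 := inverseDensity_mul_optimalDensity hR
  have h2 : ENNReal.ofReal inverseDensity * density (hexagonalMeasure hR) = 1 :=
    le_antisymm (inverseDensity_mul_density_le hR (isInvariantProbability_hexagonalMeasure hR))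
      (one_le_density_hexagonalMeasure hR)
  have h3 : ENNReal.ofReal inverseDensity ≠ 0 := fun h => by simp [h] at h1
  exact (ENNReal.mul_right_inj h3 ENNReal.ofReal_ne_top).1 (h2.trans h1.symm)

theorem isErgodicProbability_hexagonalMeasure (hR : 0 < R) :
    IsErgodicProbability (hexagonalMeasure hR) := by
  refine ⟨isInvariantProbability_hexagonalMeasure hR, fun a₁ a₂ μ₁ μ₂ ha₁ ha₂ hμ₁ hμ₂ h => ?_⟩
  have := isProbabilityMeasure_cellMotionMeasure hR
  obtain ⟨D₀, hD₀⟩ := exists_norm_trans_le hR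
  have hinv := smulInvariantMeasure_hexagonalMeasure hR
  have hac₁ : μ₁ ≪ hexagonalMeasure hR := by
    rw [h]
    refine Measure.AbsolutelyContinuous.mk fun s _ hs => ?_
    have h0 := (add_eq_zero.1 hs).1
    simpa [ha₁.ne'] using h0
  have hac₂ : μ₂ ≪ hexagonalMeasure hR := by
    rw [h]
    refine Measure.AbsolutelyContinuous.mk fun s _ hs => ?_
    have h0 := (add_eq_zero.1 hs).2
    simpa [ha₂.ne'] using h0
  exact (eq_of_absolutelyContinuous hinv hD₀ hμ₁ hac₁).trans
    (eq_of_absolutelyContinuous hinv hD₀ hμ₂ hac₂).symm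

/-- Continuous functions are bounded on the orbit of the hexagonal packing. -/
theorem exists_abs_le_on_orbit (hR : 0 < R) (f : C(DiskPacking R, ℝ)) :
    ∃ C : ℝ, ∀ g : RigidMotion, |f (g • hexagonal R)| ≤ C := by
  have hRC : (2 * R : ℂ) ≠ 0 := by
    have : (R : ℂ) ≠ 0 := by exact_mod_cast hR.ne'
    simpa using this
  have hK : IsCompact ((Set.univ : Set Circle) ×ˢ Metric.closedBall (0 : ℂ) (2 * R)) :=
    isCompact_univ.prod (isCompact_closedBall _ _)
  have hc : Continuous fun p : Circle × ℂ => f (rotTrans p • hexagonal R) :=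
    f.continuous.comp (continuous_rotTrans.smul continuous_const)
  obtain ⟨C, hC⟩ := hK.exists_bound_of_continuousOn hc.continuousOn
  refine ⟨C, fun g => ?_⟩
  set t : ℂ := (g.rot⁻¹ : Circle) * g.trans with ht
  obtain ⟨a, b, hab⟩ := exists_norm_sub_lattice_lt (t / (2 * R))
  set s : ℂ := t - 2 * R * (a + b * sixthRoot) with hs
  have hg : g • hexagonal R = rotTrans (g.rot, s) • hexagonal R := by
    rw [← rotTrans_smul_hexagonal_add hR g.rot s (mem_hexagonal.2 ⟨a, b, rfl⟩)]
    congr 1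
    ext
    · rfl
    · simp only [rotTrans]
      rw [hs, sub_add_cancel, ht, ← mul_assoc, ← Circle.coe_mul, mul_inv_cancel, Circle.coe_one,
        one_mul]
  rw [hg]
  refine hC (g.rot, s) ⟨trivial, ?_⟩
  have h1 : s = 2 * R * (t / (2 * R) - (a + b * sixthRoot)) := by
    rw [mul_sub, mul_div_cancel₀ _ hRC]
  rw [mem_closedBall_zero_iff, h1, norm_mul, norm_mul, Complex.norm_real,
    Real.norm_of_nonneg hR.le, Complex.norm_ofNat]
  nlinarith

theorem isOptimallyDense_smul_hexagonal (hR : 0 < R) (h : RigidMotion) :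
    (h • hexagonal R).IsOptimallyDense := by
  have := isProbabilityMeasure_cellMotionMeasure hR
  obtain ⟨D₀, hD₀⟩ := exists_norm_trans_le hR
  have hinv := smulInvariantMeasure_hexagonalMeasure hR
  refine ⟨hexagonalMeasure hR,
    ⟨isErgodicProbability_hexagonalMeasure hR, density_hexagonalMeasure hR⟩,
    orbit_subset_support_of_invariant hinv h, fun p f => ?_⟩
  obtain ⟨C, hC⟩ := exists_abs_le_on_orbit hR f
  simp only [setAverage_haar_eq]
  exact tendsto_setAverage_of_invariant hinv hD₀ h p f.continuous.measurable hC

end DiskPacking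

theorem theorem1 (R : ℝ) (hR : 0 < R) :
    {P : DiskPacking R | P.IsOptimallyDense} =
      MulAction.orbit RigidMotion (DiskPacking.hexagonal R) := by
  refine Set.Subset.antisymm ?_ ?_
  · rintro P ⟨μ, ⟨herg, hopt⟩, hgen⟩
    refine DiskPacking.mem_orbit_hexagonal_of_mem_support hR herg.1 ?_ hgen.1
    rw [hopt, DiskPacking.inverseDensity_mul_optimalDensity hR]
  · rintro _ ⟨g, rfl⟩
    exact DiskPacking.isOptimallyDense_smul_hexagonal hR g
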